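/- Let $K$ be a field with $2\ne0$ in $K$ (for instance $K=\mathbb C$) and $h,g,z\in K$. **The quantum group.** Let $\mathcal A=GL_{h,g}(2)$ be the Hopf algebra over $K$ generated by $a,b,c,d,\mathcal D^{-1}$ with relations $$ca=ac-gc^2,\quad cd=dc-hc^2,\quad db=bd+g(\mathcal D-d^2),\quad ab=ba+h(\mathcal D-a^2),$$ $$cb=bc-hac-gdc+ghc^2,\quad da=ad+hac-gdc,\quad \mathcal D\mathcal D^{-1}=\mathcal D^{-1}\mathcal D=1,\qquad \mathcal D=ad-bc+hac,$$ with coproduct $\Delta$ and counit $\varepsilon$ for which $T=\begin{pmatrix}a&b\\c&d\end{pmatrix}$ is a matrix coalgebra ($\Delta(T_{ij})=\sum_kT_{ik}\otimes T_{kj}$, $\varepsilon(T_{ij})=\delta_{ij}$) and $\mathcal D^{-1}$ is group-like, and with antipode $S(a)=\mathcal D^{-1}(d+gc)$, $S(b)=\mathcal D^{-1}(gd-ga-b+g^2c)$, $S(c)=-\mathcal D^{-1}c$, $S(d)=\mathcal D^{-1}(a-gc)$, $S(\mathcal D^{-1})=\mathcal D$. The dual $\mathcal A^*$ carries the convolution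 product $(\alpha\beta)(x)=\alpha(x_{(1)})\beta(x_{(2)})$. **The calculi.** A first order bicovariant differential calculus on $\mathcal A$ consists of an $\mathcal A$-bimodule $\Gamma$, a linear map $\mathrm d:\mathcal A\to\Gamma$ with $\mathrm d(xy)=(\mathrm dx)y+x\,\mathrm dy$ such that $\Gamma$ is spanned by the elements $x\,\mathrm dy$, and coactions $\Delta_L:\Gamma\to \mathcal A\otimes\Gamma$, $\Delta_R:\Gamma\to\Gamma\otimes \mathcal A$ making $\Gamma$ an $\mathcal A$-bicomodule, such that $\Delta_L(x\omega y)=\Delta(x)\Delta_L(\omega)\Delta(y)$, $\Delta_R(x\omega y)=\Delta(x)\Delta_R(\omega)\Delta(y)$, $\Delta_L\mathrm d=(\mathrm{id}\otimes\mathrm d)\Delta$ and $\Delta_R\mathrm d=(\mathrm d\otimes\mathrm{id})\Delta$. Let $\Gamma_{\rm inv}=\{\omega:\Delta_L\omega=1\otimes\omega\}$, let $P:\Gamma\to\Gamma_{\rm inv}$ be $P(\omega)=S(\omega_{(A)})\omega_{(\Gamma)}$, where $\Delta_L\omega=\omega_{(A)}\otimes\omega_{(\Gamma)}$, and put $\theta_1=P(\mathrm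 da)$, $\theta_2=P(\mathrm db)$, $\theta_3=P(\mathrm dc)$, $\theta_4=P(\mathrm dd)$. The calculus is called a 4D calculus with $ABCD$ matrices $A,B,C,D\in M_4(K)$ if $\theta_1,\dots,\theta_4$ is a basis of $\Gamma_{\rm inv}$ and $$\theta_ia=\sum_j(aA_{ij}+bC_{ij})\theta_j,\quad\theta_ib=\sum_j(aB_{ij}+bD_{ij})\theta_j,\quad\theta_ic=\sum_j(cA_{ij}+dC_{ij})\theta_j,\quad\theta_id=\sum_j(cB_{ij}+dD_{ij})\theta_j.$$ The families $\Gamma^{\rm 4D}_1$ (for $z\neq-1$), $\Gamma^{\rm 4D}_2$ (for all $z$) and $\Gamma^{\rm 4D}_3$ (for $z\neq-1$) consist of the 4D calculi with the following $ABCD$ matrices. $\Gamma^{\rm 4D}_1$: $$A=\begin{pmatrix} \frac{3z+2}{2} & 0 & \frac{-(3h+g)z-2h}{2} & \frac{-z}{2}\\ h(z+1) & z+1 & -h^{2}(z+1) & -h(z+1)\\ 0 & 0 & z+1 & 0\\ \frac{z}{2} & 0 & \frac{(h-g)z+2h}{2} & \frac{z+2}{2} \end{pmatrix}, \quad B=\begin{pmatrix}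 0 & z & h(h+g)(z+1) & 0\\ 0 & (h+g)(z+1) & -hg(h+g)(z+1) & 0\\ 0 & 0 & -(h+g)(z+1) & 0\\ 0 & z & g(h+g)(z+1) & 0 \end{pmatrix}, \quad C=\begin{pmatrix} 0 & 0 & z & 0\\ 0 & 0 & 0 & 0\\ 0 & 0 & 0 & 0\\ 0 & 0 & z & 0 \end{pmatrix}, \quad D=\begin{pmatrix} \frac{z+2}{2} & 0 & \frac{-(h-g)z+2g}{2} & \frac{z}{2}\\ -g(z+1) & z+1 & -g^{2}(z+1) & g(z+1)\\ 0 & 0 & z+1 & 0\\ \frac{-z}{2} & 0 & \frac{-(h+3g)z-2g}{2} & \frac{3z+2}{2} \end{pmatrix}.$$ $\Gamma^{\rm 4D}_2$: $$A=\begin{pmatrix} \frac{z+2}{2} & 0 & \frac{(h+g)z-2h}{2} & \frac{z}{2}\\ h(z+1) & 1 & h((h+g)z-h) & h(z-1)\\ 0 & 0 & 1 & 0\\ \frac{-z}{2} & 0 & \frac{-(h+g)z+2h}{2} & \frac{-z+2}{2} \end{pmatrix}, \quad B=\begin{pmatrix} -hz & 0 & h(h+g)(1-z) & -hz\\ hgz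 & (h+g) & hg(h+g)(z-1) & ghz\\ z & 0 & (h+g)(z-1) & z\\ -gz & 0 & g(h+g)(1-z) & -gz \end{pmatrix}, \quad C=\begin{pmatrix} 0 & 0 & 0 & 0\\ z & 0 & (h+g)z & z\\ 0 & 0 & 0 & 0\\ 0 & 0 & 0 & 0 \end{pmatrix}, \quad D=\begin{pmatrix} \frac{-z+2}{2} & 0 & \frac{-(h+g)z+2g}{2} & \frac{-z}{2}\\ g(z-1) & 1 & g((h+g)z-g) & g(z+1)\\ 0 & 0 & 1 & 0\\ \frac{z}{2} & 0 & \frac{(h+g)z-2g}{2} & \frac{z+2}{2} \end{pmatrix}.$$ $\Gamma^{\rm 4D}_3$: $$A=\begin{pmatrix} \frac{z+2}{2} & 0 & \frac{(h+g)z-2h}{2} & \frac{z}{2}\\ h & 1 & -h^{2} & -h\\ 0 & 0 & 1 & 0\\ \frac{z}{2} & 0 & \frac{(h+g)z+2h}{2} & \frac{z+2}{2} \end{pmatrix}, \quad B=\begin{pmatrix} 0 & 0 & h(h+g) & 0\\ 0 & (h+g) & -hg(h+g) & 0\\ 0 & 0 & -(h+g) & 0\\ 0 & 0 & g(h+g)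 & 0 \end{pmatrix}, \quad C=\begin{pmatrix} 0 & 0 & 0 & 0\\ 0 & 0 & 0 & 0\\ 0 & 0 & 0 & 0\\ 0 & 0 & 0 & 0 \end{pmatrix}, \quad D=\begin{pmatrix} \frac{z+2}{2} & 0 & \frac{(h+g)z+2g}{2} & \frac{z}{2}\\ -g & 1 & -g^{2} & g\\ 0 & 0 & 1 & 0\\ \frac{z}{2} & 0 & \frac{(h+g)z-2g}{2} & \frac{z+2}{2} \end{pmatrix}.$$ **The quantum Lie algebras.** For such a calculus let $\mathcal R=\{x\in\ker\varepsilon:P(\mathrm dx)=0\}$ and let $\mathcal L=(\ker\varepsilon/\mathcal R)^*$, viewed as the space of functionals on $\mathcal A$ that vanish on $1$ and on $\mathcal R$. There is a unique bilinear pairing $\Gamma\times\mathcal L\to K$ with $\langle x\omega,\chi\rangle=\varepsilon(x)\langle\omega,\chi\rangle$ and $\langle\mathrm dx,\chi\rangle=\chi(x)$, and $\mathcal L$ has a unique basis $\chi_1,\dots,\chi_4$ with $\langle\theta_i,\chi_j\rangle=\delta_{ij}$. There are unique functionals $f_{ij}\in \mathcal A^*$ and elements $v_{ij}\in \mathcal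 A$ with $\theta_ix=\sum_j x_{(1)}f_{ij}(x_{(2)})\theta_j$ for all $x\in \mathcal A$ and $\Delta_R(\theta_i)=\sum_j\theta_j\otimes v_{ji}$; put $\Lambda_{st,ik}=f_{sk}(v_{it})$. The quantum Lie bracket is the right adjoint action, $[\chi,\psi](x)=\chi(x_{(2)})\,\psi(S(x_{(1)})x_{(3)})$. **Theorem.** For the quantum Lie algebras $\mathcal L^{\rm 4D}_1$, $\mathcal L^{\rm 4D}_2$, $\mathcal L^{\rm 4D}_3$ of the calculi $\Gamma^{\rm 4D}_1$, $\Gamma^{\rm 4D}_2$, $\Gamma^{\rm 4D}_3$ one has in $\mathcal A^*$, for all $i,k$, $$[\chi_i,\chi_k]=\chi_i\chi_k-\sum_{s,t}\Lambda_{st,ik}\,\chi_s\chi_t ,$$ and the brackets, and the explicit forms of these quantum commutators, are the following. (The explicit form of $\chi_i\chi_k-\sum_{s,t}\Lambda_{st,ik}\chi_s\chi_t$ is an identity already in the tensor algebra of $\mathcal L$; that is, it lists all components $\Lambda_{st,ik}$.) $\mathcal L^{\rm 4D}_1$, brackets: $$\begin{aligned} [\chi_{1},\chi_{1}]&=0,\\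 [\chi_{1},\chi_{2}]&=\frac{1}{z+1}\chi_{2},\\ [\chi_{1},\chi_{3}]&=-\frac{1}{z+1}\chi_{3}+\frac{h+g}{z+1}\chi_{4},\\ [\chi_{1},\chi_{4}]&=0,\\ [\chi_{2},\chi_{1}]&=-\frac{1}{z+1}\chi_{2},\\ [\chi_{2},\chi_{2}]&=0,\\ [\chi_{2},\chi_{3}]&=\frac{1}{z+1}\chi_{1}-\frac{h+g}{z+1}\chi_{2}-\frac{1}{z+1}\chi_{4},\\ [\chi_{2},\chi_{4}]&=\frac{1}{z+1}\chi_{2},\\ [\chi_{3},\chi_{1}]&=-\frac{h+g}{z+1}\chi_{1}+\frac{1}{z+1}\chi_{3},\\ [\chi_{3},\chi_{2}]&=-\frac{1}{z+1}\chi_{1}-\frac{h+g}{z+1}\chi_{2}+\frac{1}{z+1}\chi_{4},\\ [\chi_{3},\chi_{3}]&=\frac{(h+g)^{2}}{z+1}\chi_{1}-2\frac{h+g}{z+1}\chi_{3}+ \frac{(h+g)^{2}}{z+1}\chi_{4},\\ [\chi_{3},\chi_{4}]&=\frac{h+g}{z+1}\chi_{1}-\frac{1}{z+1}\chi_{3},\\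 [\chi_{4},\chi_{1}]&=0,\\ [\chi_{4},\chi_{2}]&=-\frac{1}{z+1}\chi_{2},\\ [\chi_{4},\chi_{3}]&=\frac{1}{z+1}\chi_{3}-\frac{h+g}{z+1}\chi_{4},\\ [\chi_{4},\chi_{4}]&=0. \end{aligned}$$ $\mathcal L^{\rm 4D}_1$, commutators: $$\begin{aligned} [\chi_{1},\chi_{1}]&=0,\\ [\chi_{1},\chi_{2}]&=\chi_{1}\chi_{2}-(\frac{z}{z+1}\chi_{1}\chi_{2}+\chi_{2}\chi_{1} +(h+g)\chi_{2}\chi_{2}+\frac{z}{z+1}\chi_{4}\chi_{2}),\\ [\chi_{1},\chi_{3}]&=\chi_{1}\chi_{3}-(-\frac{z}{z+1}\chi_{1}\chi_{3}+ \frac{z(h+g)}{z+1}\chi_{1}\chi_{4}+\chi_{3}\chi_{1}-(h+g)\chi_{3}\chi_{2}+(h+g)^{2}\chi_{4}\chi_{2} -\frac{z}{z+1}\chi_{4}\chi_{3}+\frac{z(h+g)}{z+1}\chi_{4}\chi_{4}),\\ [\chi_{1},\chi_{4}]&=\chi_{1}\chi_{4}-\chi_{4}\chi_{1},\\ [\chi_{2},\chi_{1}]&=\chi_{2}\chi_{1}-(\frac{1}{z+1}\chi_{1}\chi_{2}-(h+g)\chi_{2}\chi_{2}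 -\frac{z}{z+1}\chi_{4}\chi_{2}),\\ [\chi_{2},\chi_{2}]&=0,\\ [\chi_{2},\chi_{3}]&=\chi_{2}\chi_{3}-(\frac{z}{z+1}\chi_{1}\chi_{1}+ \frac{h+g}{z+1}\chi_{1}\chi_{2}-\frac{z}{z+1}\chi_{1}\chi_{4}-(h+g)^{2}\chi_{2}\chi_{2}+ \chi_{3}\chi_{2} +\frac{z}{z+1}\chi_{4}\chi_{1}-\frac{(h+g)(2z+1)}{z+1}\chi_{4}\chi_{2}- \frac{z}{z+1}\chi_{4}\chi_{4}),\\ [\chi_{2},\chi_{4}]&=\chi_{2}\chi_{4}-(\frac{z}{z+1}\chi_{1}\chi_{2}+(h+g)\chi_{2}\chi_{2}+ \frac{2z+1}{z+1}\chi_{4}\chi_{2}),\\ [\chi_{3},\chi_{1}]&=\chi_{3}\chi_{1}-(-\frac{z(h+g)}{z+1}\chi_{1}\chi_{1}+ \frac{2z+1}{z+1}\chi_{1}\chi_{3}-(h+g)^{2}\chi_{2}\chi_{1}+(h+g)\chi_{2}\chi_{3} -\frac{z(h+g)}{z+1}\chi_{4}\chi_{1}+\frac{z}{z+1}\chi_{4}\chi_{3}),\\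 [\chi_{3},\chi_{2}]&=\chi_{3}\chi_{2}-(-\frac{z}{z+1}\chi_{1}\chi_{1}- \frac{z(h+g)}{z+1}\chi_{1}\chi_{2}+\frac{z}{z+1}\chi_{1}\chi_{4}-(h+g)\chi_{2}\chi_{1} -(h+g)^{2}\chi_{2}\chi_{2}+\chi_{2}\chi_{3}+(h+g)\chi_{2}\chi_{4}- \frac{z}{z+1}\chi_{4}\chi_{1}- \frac{z(h+g)}{z+1}\chi_{4}\chi_{2} +\frac{z}{z+1}\chi_{4}\chi_{4}),\\ [\chi_{3},\chi_{3}]&=\chi_{3}\chi_{3}-(\frac{z(h+g)^{2}}{z+1}\chi_{1}\chi_{1}- \frac{(h+g)(3z+1)}{z+1}\chi_{1}\chi_{3}+\frac{(h+g)^{2}(2z+1)}{z+1}\chi_{1}\chi_{4} +(h+g)^{3}\chi_{2}\chi_{1}-(h+g)^{2}\chi_{2}\chi_{3}+(h+g)\chi_{3}\chi_{1}- (h+g)^{2}\chi_{3}\chi_{2}+\chi_{3}\chi_{3} -(h+g)\chi_{3}\chi_{4}-\frac{(h+g)^{2}}{z+1}\chi_{4}\chi_{1}+(h+g)^{3}\chi_{4}\chi_{2}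 -\frac{(h+g)(z-1)}{z+1}\chi_{4}\chi_{3} +\frac{z(h+g)^{2}}{z+1}\chi_{4}\chi_{4}),\\ [\chi_{3},\chi_{4}]&=\chi_{3}\chi_{4}-(\frac{z(h+g)}{z+1}\chi_{1}\chi_{1}- \frac{z}{z+1}\chi_{1}\chi_{3}+(h+g)^{2}\chi_{2}\chi_{1}-(h+g)\chi_{2}\chi_{3} +\frac{z(h+g)}{z+1}\chi_{4}\chi_{1}+\frac{1}{z+1}\chi_{4}\chi_{3}),\\ [\chi_{4},\chi_{1}]&=\chi_{4}\chi_{1}-\chi_{1}\chi_{4},\\ [\chi_{4},\chi_{2}]&=\chi_{4}\chi_{2}-(-\frac{z}{z+1}\chi_{1}\chi_{2}- (h+g)\chi_{2}\chi_{2}+\chi_{2}\chi_{4}-\frac{z}{z+1}\chi_{4}\chi_{2}),\\ [\chi_{4},\chi_{3}]&=\chi_{4}\chi_{3}-(\frac{z}{z+1}\chi_{1}\chi_{3}- \frac{z(h+g)}{z+1}\chi_{1}\chi_{4}+(h+g)\chi_{3}\chi_{2}+\chi_{3}\chi_{4}- (h+g)^{2}\chi_{4}\chi_{2} +\frac{z}{z+1}\chi_{4}\chi_{3}-\frac{z(h+g)}{z+1}\chi_{4}\chi_{4}),\\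 [\chi_{4},\chi_{4}]&=0. \end{aligned}$$ $\mathcal L^{\rm 4D}_2$, brackets: $$\begin{aligned} [\chi_{1},\chi_{1}]&=z\chi_{1}-z\chi_{4},\\ [\chi_{1},\chi_{2}]&=\chi_{2},\\ [\chi_{1},\chi_{3}]&=z(h+g)\chi_{1}-\chi_{3}-(z-1)(h+g)\chi_{4},\\ [\chi_{1},\chi_{4}]&=z\chi_{1}-z\chi_{4},\\ [\chi_{2},\chi_{1}]&=(2z-1)\chi_{2},\\ [\chi_{2},\chi_{2}]&=0,\\ [\chi_{2},\chi_{3}]&=\chi_{1}+(2z-1)(h+g)\chi_{2}-\chi_{4},\\ [\chi_{2},\chi_{4}]&=(2z+1)\chi_{2},\\ [\chi_{3},\chi_{1}]&=-(z+1)(h+g)\chi_{1}+(2z+1)\chi_{3}-z(h+g)\chi_{4},\\ [\chi_{3},\chi_{2}]&=-\chi_{1}-(h+g)\chi_{2}+\chi_{4},\\ [\chi_{3},\chi_{3}]&=-(z-1)(h+g)^{2}\chi_{1}+2(z-1)(h+g)\chi_{3} -(z-1)(h+g)^{2}\chi_{4},\\ [\chi_{3},\chi_{4}]&=-(z-1)(h+g)\chi_{1}+(2z-1)\chi_{3}-z(h+g)\chi_{4},\\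 [\chi_{4},\chi_{1}]&=-z\chi_{1}+z\chi_{4},\\ [\chi_{4},\chi_{2}]&=-\chi_{2},\\ [\chi_{4},\chi_{3}]&=-z(h+g)\chi_{1}+\chi_{3}+(z-1)(h+g)\chi_{4},\\ [\chi_{4},\chi_{4}]&=-z\chi_{1}+z\chi_{4}. \end{aligned}$$ $\mathcal L^{\rm 4D}_2$, commutators: $$\begin{aligned} [\chi_{1},\chi_{1}]&=\chi_{1}\chi_{1}-(\chi_{1}\chi_{1}+z(h+g)\chi_{2}\chi_{1}- z\chi_{2}\chi_{3}+z\chi_{3}\chi_{2}-z(h+g)\chi_{4}\chi_{2}),\\ [\chi_{1},\chi_{2}]&=\chi_{1}\chi_{2}-(\chi_{2}\chi_{1}+(h+g)\chi_{2}\chi_{2}),\\ [\chi_{1},\chi_{3}]&=\chi_{1}\chi_{3}-(z(h+g)^{2}\chi_{2}\chi_{1}-z(h+g)\chi_{2}\chi_{3}+ \chi_{3}\chi_{1}+(h+g)(z-1)\chi_{3}\chi_{2} -(h+g)^{2}(z-1)\chi_{4}\chi_{2}),\\ [\chi_{1},\chi_{4}]&=\chi_{1}\chi_{4}-(z(h+g)\chi_{2}\chi_{1}-z\chi_{2}\chi_{3}+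 z\chi_{3}\chi_{2}+\chi_{4}\chi_{1}-z(h+g)\chi_{4}\chi_{2}),\\ [\chi_{2},\chi_{1}]&=\chi_{2}\chi_{1}-(-(z-1)\chi_{1}\chi_{2}+z\chi_{2}\chi_{1}+ (h+g)(2z-1)\chi_{2}\chi_{2}-z\chi_{2}\chi_{4} +z\chi_{4}\chi_{2}),\\ [\chi_{2},\chi_{2}]&=0,\\ [\chi_{2},\chi_{3}]&=\chi_{2}\chi_{3}-(-(h+g)(z-1)\chi_{1}\chi_{2}+z(h+g)\chi_{2}\chi_{1}+ (h+g)^{2}(2z-1)\chi_{2}\chi_{2} -z(h+g)\chi_{2}\chi_{4}+\chi_{3}\chi_{2}+(h+g)(z-1)\chi_{4}\chi_{2}),\\ [\chi_{2},\chi_{4}]&=\chi_{2}\chi_{4}-(-z\chi_{1}\chi_{2}+z\chi_{2}\chi_{1}+ (h+g)(2z+1)\chi_{2}\chi_{2}-z\chi_{2}\chi_{4}+(z+1)\chi_{4}\chi_{2}),\\ [\chi_{3},\chi_{1}]&=\chi_{3}\chi_{1}-((z+1)\chi_{1}\chi_{3}-z(h+g)\chi_{1}\chi_{4}- (h+g)^{2}(z+1)\chi_{2}\chi_{1}+(h+g)(z+1)\chi_{2}\chi_{3}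 -z\chi_{3}\chi_{1}+ z(h+g)\chi_{3}\chi_{2}+z\chi_{3}\chi_{4}+z(h+g)\chi_{4}\chi_{1}- z(h+g)^{2}\chi_{4}\chi_{2}-z\chi_{4}\chi_{3}),\\ [\chi_{3},\chi_{2}]&=\chi_{3}\chi_{2}-(-(h+g)\chi_{2}\chi_{1}- (h+g)^{2}\chi_{2}\chi_{2}+ \chi_{2}\chi_{3}+(h+g)\chi_{2}\chi_{4}),\\ [\chi_{3},\chi_{3}]&=\chi_{3}\chi_{3}-((h+g)(z-1)\chi_{1}\chi_{3}- (h+g)^{2}(z-1)\chi_{1}\chi_{4} -(h+g)^{3}(z-1)\chi_{2}\chi_{1} +(h+g)^{2}(z-1)\chi_{2}\chi_{3}-(h+g)(z-1)\chi_{3}\chi_{1}+ (h+g)^{2}(z-1)\chi_{3}\chi_{2}+\chi_{3}\chi_{3} +(h+g)(z-1)\chi_{3}\chi_{4}+ (h+g)^{2}(z-1)\chi_{4}\chi_{1}-(h+g)^{3}(z-1)\chi_{4}\chi_{2} -(h+g)(z-1)\chi_{4}\chi_{3}),\\ [\chi_{3},\chi_{4}]&=\chi_{3}\chi_{4}-(z\chi_{1}\chi_{3}-z(h+g)\chi_{1}\chi_{4}-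 (h+g)^{2}(z-1)\chi_{2}\chi_{1}+(h+g)(z-1)\chi_{2}\chi_{3} -z\chi_{3}\chi_{1}+z(h+g)\chi_{3}\chi_{2}+ z\chi_{3}\chi_{4}+z(h+g)\chi_{4}\chi_{1}-z(h+g)^{2}\chi_{4}\chi_{2} -(z-1)\chi_{4}\chi_{3}),\\ [\chi_{4},\chi_{1}]&=\chi_{4}\chi_{1}-(\chi_{1}\chi_{4}-z(h+g)\chi_{2}\chi_{1}+z\chi_{2}\chi_{3} -z\chi_{3}\chi_{2}+z(h+g)\chi_{4}\chi_{2}),\\ [\chi_{4},\chi_{2}]&=\chi_{4}\chi_{2}-(-(h+g)\chi_{2}\chi_{2}+\chi_{2}\chi_{4}),\\ [\chi_{4},\chi_{3}]&=\chi_{4}\chi_{3}-(-z(h+g)^{2}\chi_{2}\chi_{1}+z(h+g)\chi_{2}\chi_{3}- (h+g)(z-1)\chi_{3}\chi_{2}+\chi_{3}\chi_{4} +(h+g)^{2}(z-1)\chi_{4}\chi_{2}),\\ [\chi_{4},\chi_{4}]&=\chi_{4}\chi_{4}-(-z(h+g)\chi_{2}\chi_{1}+z\chi_{2}\chi_{3}-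 z\chi_{3}\chi_{2}+z(h+g)\chi_{4}\chi_{2}+\chi_{4}\chi_{4}). \end{aligned}$$ $\mathcal L^{\rm 4D}_3$, brackets: $$\begin{aligned} [\chi_{1},\chi_{1}]&=0,\\ [\chi_{1},\chi_{2}]&=\chi_{2},\\ [\chi_{1},\chi_{3}]&=-\chi_{3}+(h+g)\chi_{4},\\ [\chi_{1},\chi_{4}]&=0,\\ [\chi_{2},\chi_{1}]&=-\chi_{2},\\ [\chi_{2},\chi_{2}]&=0,\\ [\chi_{2},\chi_{3}]&=\chi_{1}-(h+g)\chi_{2}-\chi_{4},\\ [\chi_{2},\chi_{4}]&=\chi_{2},\\ [\chi_{3},\chi_{1}]&=-(h+g)\chi_{1}+\chi_{3},\\ [\chi_{3},\chi_{2}]&=-\chi_{1}-(h+g)\chi_{2}+\chi_{4},\\ [\chi_{3},\chi_{3}]&=(h+g)^{2}\chi_{1}-2(h+g)\chi_{3}+(h+g)^{2}\chi_{4},\\ [\chi_{3},\chi_{4}]&=(h+g)\chi_{1}-\chi_{3},\\ [\chi_{4},\chi_{1}]&=0,\\ [\chi_{4},\chi_{2}]&=-\chi_{2},\\ [\chi_{4},\chi_{3}]&=\chi_{3}-(h+g)\chi_{4},\\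 [\chi_{4},\chi_{4}]&=0. \end{aligned}$$ $\mathcal L^{\rm 4D}_3$, commutators: $$\begin{aligned} [\chi_{1},\chi_{1}]&=0,\\ [\chi_{1},\chi_{2}]&=\chi_{1}\chi_{2}-(\chi_{2}\chi_{1}+(h+g)\chi_{2}\chi_{2}),\\ [\chi_{1},\chi_{3}]&=\chi_{1}\chi_{3}-(\chi_{3}\chi_{1}-(h+g)\chi_{3}\chi_{2}+ (h+g)^{2}\chi_{4}\chi_{2}),\\ [\chi_{1},\chi_{4}]&=\chi_{1}\chi_{4}-\chi_{4}\chi_{1},\\ [\chi_{2},\chi_{1}]&=\chi_{2}\chi_{1}-(\chi_{1}\chi_{2}-(h+g)\chi_{2}\chi_{2}),\\ [\chi_{2},\chi_{2}]&=0,\\ [\chi_{2},\chi_{3}]&=\chi_{2}\chi_{3}-((h+g)\chi_{1}\chi_{2}-(h+g)^{2}\chi_{2}\chi_{2}+ \chi_{3}\chi_{2}-(h+g)\chi_{4}\chi_{2}),\\ [\chi_{2},\chi_{4}]&=\chi_{2}\chi_{4}-((h+g)\chi_{2}\chi_{2}+\chi_{4}\chi_{2}),\\ [\chi_{3},\chi_{1}]&=\chi_{3}\chi_{1}-(\chi_{1}\chi_{3}-(h+g)^{2}\chi_{2}\chi_{1}+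 (h+g)\chi_{2}\chi_{3}),\\ [\chi_{3},\chi_{2}]&=\chi_{3}\chi_{2}-(-(h+g)\chi_{2}\chi_{1}-(h+g)^{2}\chi_{2}\chi_{2}+ \chi_{2}\chi_{3}+(h+g)\chi_{2}\chi_{4}),\\ [\chi_{3},\chi_{3}]&=\chi_{3}\chi_{3}-(-(h+g)\chi_{1}\chi_{3}+(h+g)^{2}\chi_{1}\chi_{4}+ (h+g)^{3}\chi_{2}\chi_{1}-(h+g)^{2}\chi_{2}\chi_{3} +(h+g)\chi_{3}\chi_{1}-(h+g)^{2}\chi_{3}\chi_{2}+ \chi_{3}\chi_{3}-(h+g)\chi_{3}\chi_{4}-(h+g)^{2}\chi_{4}\chi_{1} +(h+g)^{3}\chi_{4}\chi_{2}+ (h+g)\chi_{4}\chi_{3}),\\ [\chi_{3},\chi_{4}]&=\chi_{3}\chi_{4}-((h+g)^{2}\chi_{2}\chi_{1}-(h+g)\chi_{2}\chi_{3}+ \chi_{4}\chi_{3}),\\ [\chi_{4},\chi_{1}]&=\chi_{4}\chi_{1}-\chi_{1}\chi_{4},\\ [\chi_{4},\chi_{2}]&=\chi_{4}\chi_{2}-(-(h+g)\chi_{2}\chi_{2}+\chi_{2}\chi_{4}),\\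 [\chi_{4},\chi_{3}]&=\chi_{4}\chi_{3}-((h+g)\chi_{3}\chi_{2}+\chi_{3}\chi_{4}- (h+g)^{2}\chi_{4}\chi_{2}),\\ [\chi_{4},\chi_{4}]&=0. \end{aligned}$$ -/

import Mathlib

open scoped TensorProduct
set_option linter.unusedSimpArgs false
noncomputable section

/-- A `2 × 2` matrix `(a b; c d)` with entries in an algebra, together with an element `x`,
satisfying the defining relations of `GL_{h,g}(2)`; `x` is a two-sided inverse of the quantum
determinant `a d - b c + h a c`. -/
structure IsGLPoint {K B : Type*} [CommRing K] [Ring B] [Algebra K B] (h g : K)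
    (a b c d x : B) : Prop where
  ca : c * a = a * c - g • (c * c)
  cd : c * d = d * c - h • (c * c)
  db : d * b = b * d + g • (a * d - b * c + h • (a * c) - d * d)
  ab : a * b = b * a + h • (a * d - b * c + h • (a * c) - a * a)
  cb : c * b = b * c - h • (a * c) - g • (d * c) + (g * h) • (c * c)
  da : d * a = a * d + h • (a * c) - g • (d * c)
  det_mul : (a * d - b * c + h • (a * c)) * x = 1
  mul_det : x * (a * d - b * c + h • (a * c)) = 1

theorem mul_reassoc {B : Type*} [Semigroup B] {u v w : B} (e : u * v = w) (t : B) :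
    u * (v * t) = w * t := by
  rw [← mul_assoc, e]

namespace IsGLPoint

section

variable {K B : Type*} [CommRing K] [Ring B] [Algebra K B] {h g : K} {a b c d x : B}

theorem conj (P : IsGLPoint h g a b c d x) {u u' : B} (e : u * (a * d - b * c + h • (a * c)) =
    (a * d - b * c + h • (a * c)) * u') : x * u = u' * x := by
  calc x * u = x * (u * ((a * d - b * c + h • (a * c)) * x)) := by rw [P.det_mul, mul_one]
    _ = x * ((a * d - b * c + h • (a * c)) * u') * x := by rw [← mul_assoc u, e]; simp only [mul_assoc]
    _ = u' * x := by rw [← mul_assoc x, P.mul_det, one_mul]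

theorem cx (P : IsGLPoint h g a b c d x) : c * x = x * c := by
  refine (P.conj ?_).symm
  simp only [mul_add, add_mul, mul_sub, sub_mul, smul_mul_assoc, mul_smul_comm, smul_smul,
    mul_assoc, smul_add, smul_sub, P.ca, P.cd, P.db, P.ab, P.cb, P.da, mul_reassoc P.ca,
    mul_reassoc P.cd, mul_reassoc P.db, mul_reassoc P.ab, mul_reassoc P.cb, mul_reassoc P.da]
  module

theorem ax (P : IsGLPoint h g a b c d x) : a * x = x * a + (h - g) • (x * c) := by
  have : x * (a + (h - g) • c) = a * x := by
    refine P.conj ?_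
    simp only [mul_add, add_mul, mul_sub, sub_mul, smul_mul_assoc, mul_smul_comm, smul_smul,
      mul_assoc, smul_add, smul_sub, P.ca, P.cd, P.db, P.ab, P.cb, P.da, mul_reassoc P.ca,
      mul_reassoc P.cd, mul_reassoc P.db, mul_reassoc P.ab, mul_reassoc P.cb, mul_reassoc P.da]
    module
  rw [← this, mul_add, mul_smul_comm]

theorem dx (P : IsGLPoint h g a b c d x) : d * x = x * d - (h - g) • (x * c) := by
  have : x * (d - (h - g) • c) = d * x := by
    refine P.conj ?_
    simp only [mul_add, add_mul, mul_sub, sub_mul, smul_mul_assoc, mul_smul_comm, smul_smul,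
      mul_assoc, smul_add, smul_sub, P.ca, P.cd, P.db, P.ab, P.cb, P.da, mul_reassoc P.ca,
      mul_reassoc P.cd, mul_reassoc P.db, mul_reassoc P.ab, mul_reassoc P.cb, mul_reassoc P.da]
    module
  rw [← this, mul_sub, mul_smul_comm]

theorem bx (P : IsGLPoint h g a b c d x) : b * x = x * b + (h - g) • (x * d - x * a - (h - g) • (x * c)) := by
  have : x * (b + (h - g) • (d - a - (h - g) • c)) = b * x := by
    refine P.conj ?_
    simp only [mul_add, add_mul, mul_sub, sub_mul, smul_mul_assoc, mul_smul_comm, smul_smul,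
      mul_assoc, smul_add, smul_sub, P.ca, P.cd, P.db, P.ab, P.cb, P.da, mul_reassoc P.ca,
      mul_reassoc P.cd, mul_reassoc P.db, mul_reassoc P.ab, mul_reassoc P.cb, mul_reassoc P.da]
    module
  rw [← this, mul_add, mul_smul_comm, mul_sub, mul_sub, mul_smul_comm]

theorem xad (P : IsGLPoint h g a b c d x) : x * (a * d) = 1 + x * (b * c) - h • (x * (a * c)) := by
  have := P.mul_det
  rw [mul_add, mul_sub, mul_smul_comm] at this
  rw [← this]; abel

theorem antipode (P : IsGLPoint h g a b c d x) : IsGLPoint h g (MulOpposite.op (x * (d + g • c)))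
    (MulOpposite.op (x * (g • d - g • a - b + (g ^ 2) • c))) (MulOpposite.op (-(x * c)))
    (MulOpposite.op (x * (a - g • c))) (MulOpposite.op (a * d - b * c + h • (a * c))) := by
  have e : x * (a - g • c) * (x * (d + g • c)) - -(x * c) * (x * (g • d - g • a - b + (g ^ 2) • c))
      + h • (-(x * c) * (x * (d + g • c))) = x * (x * (a * d - b * c + h • (a * c))) := by
    simp only [mul_add, add_mul, mul_sub, sub_mul, smul_mul_assoc, mul_smul_comm, smul_smul,
      mul_neg, neg_mul, smul_neg, neg_neg,
      mul_assoc, smul_add, smul_sub, P.ca, P.cd, P.db, P.ab, P.cb, P.da, mul_reassoc P.ca,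
      mul_reassoc P.cd, mul_reassoc P.db, mul_reassoc P.ab, mul_reassoc P.cb, mul_reassoc P.da,
      P.ax, P.bx, P.cx, P.dx, mul_reassoc P.ax, mul_reassoc P.bx, mul_reassoc P.cx, mul_reassoc P.dx]
    module
  rw [P.mul_det, mul_one] at e
  refine ⟨?_, ?_, ?_, ?_, ?_, ?_, ?_, ?_⟩ <;> apply MulOpposite.unop_injective <;>
    simp only [MulOpposite.unop_add, MulOpposite.unop_sub, MulOpposite.unop_smul,
      MulOpposite.unop_mul, MulOpposite.unop_op, MulOpposite.unop_one]
  case refine_7 => rw [e, P.det_mul]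
  case refine_8 => rw [e, P.mul_det]
  all_goals
    simp only [mul_add, add_mul, mul_sub, sub_mul, smul_mul_assoc, mul_smul_comm, smul_smul,
      mul_neg, neg_mul, smul_neg, neg_neg,
      mul_assoc, smul_add, smul_sub, P.ca, P.cd, P.db, P.ab, P.cb, P.da, mul_reassoc P.ca,
      mul_reassoc P.cd, mul_reassoc P.db, mul_reassoc P.ab, mul_reassoc P.cb, mul_reassoc P.da,
      P.ax, P.bx, P.cx, P.dx, mul_reassoc P.ax, mul_reassoc P.bx, mul_reassoc P.cx, mul_reassoc P.dx]
    module

end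
end IsGLPoint

/-- Generators of `GL_{h,g}(2)`: the matrix entries and the inverse of the quantum determinant. -/
inductive GLGen | a | b | c | d | detInv

/-- The generator `t` of the free algebra. -/
def freeGen (K : Type*) [CommRing K] (t : GLGen) : FreeAlgebra K GLGen := FreeAlgebra.ι K t

/-- The defining relations of `GL_{h,g}(2)`, imposed on the free algebra on the generators. -/
inductive GLRel {K : Type*} [CommRing K] (h g : K) :
    FreeAlgebra K GLGen → FreeAlgebra K GLGen → Prop
  | ca : GLRel h g (freeGen K .c * freeGen K .a) (freeGen K .a * freeGen K .c - g • (freeGen K .c * freeGen K .c))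
  | cd : GLRel h g (freeGen K .c * freeGen K .d) (freeGen K .d * freeGen K .c - h • (freeGen K .c * freeGen K .c))
  | db : GLRel h g (freeGen K .d * freeGen K .b) (freeGen K .b * freeGen K .d + g • (freeGen K .a * freeGen K .d - freeGen K .b * freeGen K .c +
      h • (freeGen K .a * freeGen K .c) - freeGen K .d * freeGen K .d))
  | ab : GLRel h g (freeGen K .a * freeGen K .b) (freeGen K .b * freeGen K .a + h • (freeGen K .a * freeGen K .d - freeGen K .b * freeGen K .c +
      h • (freeGen K .a * freeGen K .c) - freeGen K .a * freeGen K .a))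
  | cb : GLRel h g (freeGen K .c * freeGen K .b) (freeGen K .b * freeGen K .c - h • (freeGen K .a * freeGen K .c) -
      g • (freeGen K .d * freeGen K .c) + (g * h) • (freeGen K .c * freeGen K .c))
  | da : GLRel h g (freeGen K .d * freeGen K .a) (freeGen K .a * freeGen K .d + h • (freeGen K .a * freeGen K .c) -
      g • (freeGen K .d * freeGen K .c))
  | det_mul : GLRel h g ((freeGen K .a * freeGen K .d - freeGen K .b * freeGen K .c + h • (freeGen K .a * freeGen K .c)) *
      freeGen K .detInv) 1
  | mul_det : GLRel h g (freeGen K .detInv * (freeGen K .a * freeGen K .d - freeGen K .b * freeGen K .c +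
      h • (freeGen K .a * freeGen K .c))) 1

/-- The algebra underlying the Jordanian quantum group `GL_{h,g}(2)`. -/
def JordanianGL {K : Type*} [CommRing K] (h g : K) : Type _ := RingQuot (GLRel h g)

namespace JordanianGL

variable {K : Type*} [CommRing K] {h g : K}

instance : Ring (JordanianGL h g) := inferInstanceAs (Ring (RingQuot (GLRel h g)))

instance : Algebra K (JordanianGL h g) := inferInstanceAs (Algebra K (RingQuot (GLRel h g)))

variable (h g) in
/-- The quotient map. -/
def mk : FreeAlgebra K GLGen →ₐ[K] JordanianGL h g := RingQuot.mkAlgHom K (GLRel h g)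

theorem mk_rel {p q : FreeAlgebra K GLGen} (r : GLRel h g p q) : mk h g p = mk h g q :=
  RingQuot.mkAlgHom_rel K r

theorem mk_surjective : Function.Surjective (mk h g) := RingQuot.mkAlgHom_surjective K (GLRel h g)

variable (h g) in
/-- The image of a generator. -/
def gen (t : GLGen) : JordanianGL h g := mk h g (freeGen K t)

theorem point : IsGLPoint h g (gen h g .a) (gen h g .b) (gen h g .c) (gen h g .d)
    (gen h g .detInv) := by
  constructor <;> simp only [gen, ← map_mul, ← map_add, ← map_sub, ← map_smul]
  · exact mk_rel GLRel.ca
  · exact mk_rel GLRel.cd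
  · exact mk_rel GLRel.db
  · exact mk_rel GLRel.ab
  · exact mk_rel GLRel.cb
  · exact mk_rel GLRel.da
  · rw [mk_rel GLRel.det_mul, map_one]
  · rw [mk_rel GLRel.mul_det, map_one]

/-- The universal property of the presentation. -/
def lift {B : Type*} [Ring B] [Algebra K B] (φ : GLGen → B)
    (P : IsGLPoint h g (φ .a) (φ .b) (φ .c) (φ .d) (φ .detInv)) : JordanianGL h g →ₐ[K] B :=
  RingQuot.liftAlgHom K ⟨FreeAlgebra.lift K φ, by
    intro p q r
    cases r <;> simp only [map_mul, map_add, map_sub, map_smul, map_one, freeGen, FreeAlgebra.lift_ι_apply]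
    exacts [P.ca, P.cd, P.db, P.ab, P.cb, P.da, P.det_mul, P.mul_det]⟩

@[simp]
theorem lift_gen {B : Type*} [Ring B] [Algebra K B] (φ : GLGen → B)
    (P : IsGLPoint h g (φ .a) (φ .b) (φ .c) (φ .d) (φ .detInv)) (t : GLGen) :
    lift φ P (gen h g t) = φ t := by
  refine (RingQuot.liftAlgHom_mkAlgHom_apply K _ _ _).trans ?_
  exact FreeAlgebra.lift_ι_apply _ _

theorem algHom_ext {B : Type*} [Ring B] [Algebra K B] {φ ψ : JordanianGL h g →ₐ[K] B}
    (e : ∀ t, φ (gen h g t) = ψ (gen h g t)) : φ = ψ := by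
  refine RingQuot.ringQuot_ext' K φ ψ (FreeAlgebra.hom_ext ?_)
  funext t
  exact e t

/-- Values of the coproduct on the generators. -/
def comulGen : GLGen → JordanianGL h g ⊗[K] JordanianGL h g
  | .a => gen h g .a ⊗ₜ gen h g .a + gen h g .b ⊗ₜ gen h g .c
  | .b => gen h g .a ⊗ₜ gen h g .b + gen h g .b ⊗ₜ gen h g .d
  | .c => gen h g .c ⊗ₜ gen h g .a + gen h g .d ⊗ₜ gen h g .c
  | .d => gen h g .c ⊗ₜ gen h g .b + gen h g .d ⊗ₜ gen h g .d
  | .detInv => gen h g .detInv ⊗ₜ gen h g .detInv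

/-- Values of the counit on the generators. -/
def counitGen : GLGen → K
  | .a => 1
  | .b => 0
  | .c => 0
  | .d => 1
  | .detInv => 1

variable (h g) in
/-- The quantum determinant. -/
def det : JordanianGL h g :=
  gen h g .a * gen h g .d - gen h g .b * gen h g .c + h • (gen h g .a * gen h g .c)

/-- Values of the antipode on the generators. -/
def antipodeGen : GLGen → JordanianGL h g
  | .a => gen h g .detInv * (gen h g .d + g • gen h g .c)
  | .b => gen h g .detInv * (g • gen h g .d - g • gen h g .a - gen h g .b + (g ^ 2) • gen h g .c)
  | .c => -(gen h g .detInv * gen h g .c)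
  | .d => gen h g .detInv * (gen h g .a - g • gen h g .c)
  | .detInv => det h g

theorem comulGen_point : IsGLPoint h g (comulGen (h := h) (g := g) .a) (comulGen .b) (comulGen .c)
    (comulGen .d) (comulGen .detInv) := by
  have P := point (h := h) (g := g)
  have e : comulGen (h := h) (g := g) .a * comulGen .d - comulGen .b * comulGen .c +
      h • (comulGen .a * comulGen .c) = det h g ⊗ₜ det h g := by
    simp only [comulGen, det, mul_add, add_mul, Algebra.TensorProduct.tmul_mul_tmul,
      TensorProduct.tmul_add, TensorProduct.add_tmul, TensorProduct.tmul_sub,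
      TensorProduct.sub_tmul, TensorProduct.tmul_smul, ← TensorProduct.smul_tmul', smul_add,
      smul_sub, smul_smul, P.ca, P.cd, P.db, P.ab, P.cb, P.da]
    module
  refine ⟨?_, ?_, ?_, ?_, ?_, ?_, ?_, ?_⟩
  case refine_7 =>
    rw [e]
    simp only [comulGen, det, Algebra.TensorProduct.tmul_mul_tmul, P.det_mul]; rfl
  case refine_8 =>
    rw [e]
    simp only [comulGen, det, Algebra.TensorProduct.tmul_mul_tmul, P.mul_det]; rfl
  all_goals
    simp only [comulGen, mul_add, add_mul, Algebra.TensorProduct.tmul_mul_tmul,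
      TensorProduct.tmul_add, TensorProduct.add_tmul, TensorProduct.tmul_sub,
      TensorProduct.sub_tmul, TensorProduct.tmul_smul, ← TensorProduct.smul_tmul', smul_add,
      smul_sub, smul_smul, P.ca, P.cd, P.db, P.ab, P.cb, P.da]
    module

theorem counitGen_point : IsGLPoint h g (counitGen (K := K) .a) (counitGen .b) (counitGen .c)
    (counitGen .d) (counitGen .detInv) := by
  constructor <;> simp [counitGen]

/-- `GL_{h,g}(2)` as a bialgebra. -/
instance : Bialgebra K (JordanianGL h g) :=
  Bialgebra.ofAlgHom (lift comulGen comulGen_point) (lift counitGen counitGen_point)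
    (algHom_ext fun t => by
      cases t <;> simp [comulGen, TensorProduct.add_tmul, TensorProduct.tmul_add] <;> abel)
    (algHom_ext fun t => by cases t <;> simp [comulGen, counitGen])
    (algHom_ext fun t => by cases t <;> simp [comulGen, counitGen])

/-- The antipode as an algebra map to the opposite algebra. -/
def antipodeHom : JordanianGL h g →ₐ[K] (JordanianGL h g)ᵐᵒᵖ :=
  lift (fun t => MulOpposite.op (antipodeGen t)) point.antipode

theorem comul_gen (t : GLGen) : Coalgebra.comul (R := K) (gen h g t) = comulGen t :=
  lift_gen comulGen comulGen_point t

theorem counit_gen (t : GLGen) : Coalgebra.counit (R := K) (gen h g t) = counitGen t :=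
  lift_gen counitGen counitGen_point t

theorem induction {C : JordanianGL h g → Prop} (h1 : ∀ r : K, C (algebraMap K _ r))
    (h2 : ∀ t, C (gen h g t)) (h3 : ∀ p q, C p → C q → C (p * q))
    (h4 : ∀ p q, C p → C q → C (p + q)) (p : JordanianGL h g) : C p := by
  obtain ⟨p, rfl⟩ := mk_surjective p
  induction p using FreeAlgebra.induction with
  | grade0 r => rw [AlgHom.commutes]; exact h1 r
  | grade1 t => exact h2 t
  | mul p q hp hq => rw [map_mul]; exact h3 _ _ hp hq
  | add p q hp hq => rw [map_add]; exact h4 _ _ hp hq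

theorem antipodeHom_gen (t : GLGen) :
    antipodeHom (gen h g t) = MulOpposite.op (antipodeGen t) :=
  lift_gen _ _ t

/-- The antipode as a linear map. -/
def antipodeLin : JordanianGL h g →ₗ[K] JordanianGL h g :=
  (MulOpposite.opLinearEquiv K).symm.toLinearMap ∘ₗ antipodeHom.toLinearMap

theorem antipodeLin_gen (t : GLGen) : antipodeLin (gen h g t) = antipodeGen t := by
  change (antipodeHom (gen h g t)).unop = _
  rw [antipodeHom_gen]; rfl

theorem antipodeLin_mul (p q : JordanianGL h g) :
    antipodeLin (p * q) = antipodeLin q * antipodeLin p := by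
  change (antipodeHom (p * q)).unop = _
  rw [map_mul]; rfl

theorem antipodeLin_algebraMap (r : K) :
    antipodeLin (algebraMap K (JordanianGL h g) r) = algebraMap K _ r := by
  change (antipodeHom (algebraMap K (JordanianGL h g) r)).unop = _
  rw [AlgHom.commutes]; rfl

theorem antipode_left (p : JordanianGL h g) :
    LinearMap.mul' K (JordanianGL h g)
      (antipodeLin.rTensor (JordanianGL h g) (Coalgebra.comul (R := K) p)) =
      algebraMap K (JordanianGL h g) (Coalgebra.counit (R := K) p) := by
  have P := point (h := h) (g := g)
  induction p using induction with
  | h1 r =>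
    rw [Bialgebra.comul_algebraMap, Bialgebra.counit_algebraMap,
      Algebra.TensorProduct.algebraMap_apply, LinearMap.rTensor_tmul, antipodeLin_algebraMap,
      LinearMap.mul'_apply, mul_one]
  | h2 t =>
    rw [comul_gen, counit_gen]
    cases t <;> simp only [comulGen, counitGen, map_add, LinearMap.rTensor_tmul,
      LinearMap.mul'_apply, antipodeLin_gen, antipodeGen, map_zero, map_one]
    case detInv => exact P.det_mul
    all_goals
      simp only [mul_add, add_mul, mul_sub, sub_mul, smul_mul_assoc, mul_smul_comm, smul_smul,
        mul_neg, neg_mul, smul_neg, neg_neg,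
        mul_assoc, smul_add, smul_sub, P.ca, P.cd, P.db, P.ab, P.cb, P.da, P.xad]
      module
  | h3 p q hp hq =>
    have key : ∀ u v : JordanianGL h g ⊗[K] JordanianGL h g, ∀ r : K,
        LinearMap.mul' K _ (antipodeLin.rTensor (JordanianGL h g) u) = algebraMap K _ r →
        LinearMap.mul' K _ (antipodeLin.rTensor (JordanianGL h g) (u * v)) =
        algebraMap K _ r * LinearMap.mul' K _ (antipodeLin.rTensor (JordanianGL h g) v) := by
      intro u v r e
      induction v with
      | zero => simp only [mul_zero, map_zero]
      | add v w hv hw => simp only [mul_add, map_add, hv, hw]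
      | tmul v w =>
        have : ∀ u : JordanianGL h g ⊗[K] JordanianGL h g,
            LinearMap.mul' K _ (antipodeLin.rTensor (JordanianGL h g) (u * v ⊗ₜ w)) =
            antipodeLin v * LinearMap.mul' K _ (antipodeLin.rTensor (JordanianGL h g) u) * w := by
          intro u
          induction u with
          | zero => simp only [zero_mul, map_zero, mul_zero]
          | add u u' hu hu' => simp only [add_mul, mul_add, map_add, hu, hu']
          | tmul u u' =>
            simp only [Algebra.TensorProduct.tmul_mul_tmul, LinearMap.rTensor_tmul,
              LinearMap.mul'_apply, antipodeLin_mul, mul_assoc]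
        rw [this, e, LinearMap.rTensor_tmul, LinearMap.mul'_apply, ← mul_assoc,
          Algebra.commutes r]
    rw [Bialgebra.comul_mul, Bialgebra.counit_mul, key _ _ _ hp, hq, ← map_mul]
  | h4 p q hp hq => simp only [map_add, hp, hq]

theorem antipode_right (p : JordanianGL h g) :
    LinearMap.mul' K (JordanianGL h g)
      (antipodeLin.lTensor (JordanianGL h g) (Coalgebra.comul (R := K) p)) =
      algebraMap K (JordanianGL h g) (Coalgebra.counit (R := K) p) := by
  have P := point (h := h) (g := g)
  induction p using induction with
  | h1 r =>
    rw [Bialgebra.comul_algebraMap, Bialgebra.counit_algebraMap,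
      Algebra.TensorProduct.algebraMap_apply, LinearMap.lTensor_tmul,
      ← map_one (algebraMap K (JordanianGL h g)), antipodeLin_algebraMap,
      LinearMap.mul'_apply, map_one, mul_one]
  | h2 t =>
    rw [comul_gen, counit_gen]
    cases t <;> simp only [comulGen, counitGen, map_add, LinearMap.lTensor_tmul,
      LinearMap.mul'_apply, antipodeLin_gen, antipodeGen, map_zero, map_one]
    case detInv => exact P.mul_det
    all_goals
      simp only [mul_add, add_mul, mul_sub, sub_mul, smul_mul_assoc, mul_smul_comm, smul_smul,
        mul_neg, neg_mul, smul_neg, neg_neg,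
        mul_assoc, smul_add, smul_sub, P.ca, P.cd, P.db, P.ab, P.cb, P.da, P.xad,
        P.ax, P.bx, P.cx, P.dx, mul_reassoc P.ax, mul_reassoc P.bx, mul_reassoc P.cx,
        mul_reassoc P.dx]
      module
  | h3 p q hp hq =>
    have key : ∀ u v : JordanianGL h g ⊗[K] JordanianGL h g, ∀ r : K,
        LinearMap.mul' K _ (antipodeLin.lTensor (JordanianGL h g) v) = algebraMap K _ r →
        LinearMap.mul' K _ (antipodeLin.lTensor (JordanianGL h g) (u * v)) =
        LinearMap.mul' K _ (antipodeLin.lTensor (JordanianGL h g) u) * algebraMap K _ r := by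
      intro u v r e
      induction u with
      | zero => simp only [zero_mul, map_zero]
      | add v w hv hw => simp only [add_mul, map_add, hv, hw]
      | tmul u w =>
        have : ∀ v : JordanianGL h g ⊗[K] JordanianGL h g,
            LinearMap.mul' K _ (antipodeLin.lTensor (JordanianGL h g) (u ⊗ₜ w * v)) =
            u * LinearMap.mul' K _ (antipodeLin.lTensor (JordanianGL h g) v) * antipodeLin w := by
          intro v
          induction v with
          | zero => simp only [zero_mul, map_zero, mul_zero]
          | add u u' hu hu' => simp only [add_mul, mul_add, map_add, hu, hu']
          | tmul v v' =>
            simp only [Algebra.TensorProduct.tmul_mul_tmul, LinearMap.lTensor_tmul,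
              LinearMap.mul'_apply, antipodeLin_mul, mul_assoc]
        rw [this, e, LinearMap.lTensor_tmul, LinearMap.mul'_apply, mul_assoc,
          Algebra.commutes r, mul_assoc]
    rw [Bialgebra.comul_mul, Bialgebra.counit_mul, key _ _ _ hq, hp, ← map_mul]
  | h4 p q hp hq => simp only [map_add, hp, hq]

/-- `GL_{h,g}(2)` as a Hopf algebra. -/
instance : HopfAlgebra K (JordanianGL h g) where
  antipode := antipodeLin
  mul_antipode_rTensor_comul := LinearMap.ext antipode_left
  mul_antipode_lTensor_comul := LinearMap.ext antipode_right

theorem antipode_gen (t : GLGen) : HopfAlgebra.antipode K (gen h g t) = antipodeGen t :=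
  antipodeLin_gen t

end JordanianGL

section Calculus

variable (K A Γ : Type*) [Field K] [Ring A] [HopfAlgebra K A] [AddCommGroup Γ] [Module K Γ]
  [Module A Γ] [Module Aᵐᵒᵖ Γ] [IsScalarTower K A Γ] [IsScalarTower K Aᵐᵒᵖ Γ]
  [SMulCommClass A Aᵐᵒᵖ Γ]

/-- The left action `a ↦ (ω ↦ a ω)` as a bilinear map. -/
def lact : A →ₗ[K] Γ →ₗ[K] Γ := (Algebra.lsmul K K Γ).toLinearMap

/-- The right action `a ↦ (ω ↦ ω a)` as a bilinear map. -/
def ract : A →ₗ[K] Γ →ₗ[K] Γ :=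
  (Algebra.lsmul K K Γ : Aᵐᵒᵖ →ₐ[K] Module.End K Γ).toLinearMap ∘ₗ
    (MulOpposite.opLinearEquiv K).toLinearMap

/-- The left action of `A ⊗ A` on `A ⊗ Γ`: `(a ⊗ b) (c ⊗ ω) = a c ⊗ b ω`. -/
def lactL : A ⊗[K] A →ₗ[K] A ⊗[K] Γ →ₗ[K] A ⊗[K] Γ :=
  TensorProduct.map₂ (LinearMap.mul K A) (lact K A Γ)

/-- The right action of `A ⊗ A` on `A ⊗ Γ`: `(c ⊗ ω) (a ⊗ b) = c a ⊗ ω b`. -/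
def ractL : A ⊗[K] A →ₗ[K] A ⊗[K] Γ →ₗ[K] A ⊗[K] Γ :=
  TensorProduct.map₂ (LinearMap.mul K A).flip (ract K A Γ)

/-- The left action of `A ⊗ A` on `Γ ⊗ A`: `(a ⊗ b) (ω ⊗ c) = a ω ⊗ b c`. -/
def lactR : A ⊗[K] A →ₗ[K] Γ ⊗[K] A →ₗ[K] Γ ⊗[K] A :=
  TensorProduct.map₂ (lact K A Γ) (LinearMap.mul K A)

/-- The right action of `A ⊗ A` on `Γ ⊗ A`: `(ω ⊗ c) (a ⊗ b) = ω a ⊗ c b`. -/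
def ractR : A ⊗[K] A →ₗ[K] Γ ⊗[K] A →ₗ[K] Γ ⊗[K] A :=
  TensorProduct.map₂ (ract K A Γ) (LinearMap.mul K A).flip

/-- A first order bicovariant differential calculus on the Hopf algebra `A` with bimodule of forms
`Γ`. The right action of `a` on `ω` is written `MulOpposite.op a • ω`. -/
structure BicovariantCalculus where
  /-- the differential -/
  d : A →ₗ[K] Γ
  leibniz : ∀ a b : A, d (a * b) = MulOpposite.op b • d a + a • d b
  span_d : Submodule.span A (Set.range d) = ⊤
  /-- the left coaction -/
  coactL : Γ →ₗ[K] A ⊗[K] Γ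
  /-- the right coaction -/
  coactR : Γ →ₗ[K] Γ ⊗[K] A
  coactL_coassoc : ∀ ω : Γ, coactL.lTensor A (coactL ω) =
    TensorProduct.assoc K A A Γ ((Coalgebra.comul (R := K) (A := A)).rTensor Γ (coactL ω))
  coactL_counit : ∀ ω : Γ,
    TensorProduct.lid K Γ ((Coalgebra.counit (R := K) (A := A)).rTensor Γ (coactL ω)) = ω
  coactR_coassoc : ∀ ω : Γ, TensorProduct.assoc K Γ A A (coactR.rTensor A (coactR ω)) =
    (Coalgebra.comul (R := K) (A := A)).lTensor Γ (coactR ω)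
  coactR_counit : ∀ ω : Γ,
    TensorProduct.rid K Γ ((Coalgebra.counit (R := K) (A := A)).lTensor Γ (coactR ω)) = ω
  bicomodule : ∀ ω : Γ, coactR.lTensor A (coactL ω) =
    TensorProduct.assoc K A Γ A (coactL.rTensor A (coactR ω))
  coactL_smul : ∀ (a : A) (ω : Γ),
    coactL (a • ω) = lactL K A Γ (Coalgebra.comul (R := K) a) (coactL ω)
  coactL_op_smul : ∀ (a : A) (ω : Γ),
    coactL (MulOpposite.op a • ω) = ractL K A Γ (Coalgebra.comul (R := K) a) (coactL ω)
  coactR_smul : ∀ (a : A) (ω : Γ),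
    coactR (a • ω) = lactR K A Γ (Coalgebra.comul (R := K) a) (coactR ω)
  coactR_op_smul : ∀ (a : A) (ω : Γ),
    coactR (MulOpposite.op a • ω) = ractR K A Γ (Coalgebra.comul (R := K) a) (coactR ω)
  coactL_d : ∀ a : A, coactL (d a) = d.lTensor A (Coalgebra.comul (R := K) a)
  coactR_d : ∀ a : A, coactR (d a) = d.rTensor A (Coalgebra.comul (R := K) a)

variable {K A Γ}

namespace BicovariantCalculus

variable (C : BicovariantCalculus K A Γ)

/-- The space of left-invariant forms. -/
def leftInvariants : Submodule K Γ :=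
  LinearMap.ker (C.coactL - TensorProduct.mk K A Γ 1)

/-- The projection `P ω = S(ω_A) ω_Γ` to the left-invariant forms, as a map to `Γ`. -/
def invProj : Γ →ₗ[K] Γ :=
  TensorProduct.lift (lact K A Γ ∘ₗ HopfAlgebra.antipode K) ∘ₗ C.coactL

/-- The ideal `R = {a ∈ ker ε : P(d a) = 0}` of the calculus, as a subspace. -/
def relIdeal : Submodule K A :=
  LinearMap.ker (Coalgebra.counit (R := K) (A := A)) ⊓ LinearMap.ker (C.invProj ∘ₗ C.d)

/-- The quantum Lie algebra `(ker ε / R)^*`, realised inside `A^*`, as `A = K 1 ⊕ ker ε`, by the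
functionals that vanish on `1` and on `R`. -/
def quantumLieAlgebra : Submodule K (Module.Dual K A) :=
  (Submodule.span K {(1 : A)} ⊔ C.relIdeal).dualAnnihilator

end BicovariantCalculus

variable (K A) in
/-- The right adjoint coaction `a ↦ a₍₂₎ ⊗ S(a₍₁₎) a₍₃₎`. -/
def adCoact : A →ₗ[K] A ⊗[K] A :=
  (LinearMap.mul' K A ∘ₗ (HopfAlgebra.antipode K (A := A)).rTensor A).lTensor A ∘ₗ
    (TensorProduct.leftComm K A A A).toLinearMap ∘ₗ
      (Coalgebra.comul (R := K) (A := A)).lTensor A ∘ₗ Coalgebra.comul (R := K) (A := A)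

/-- The quantum Lie bracket: the right adjoint action `S(ψ₍₁₎) χ ψ₍₂₎` of `ψ` on `χ`, that is,
`[χ, ψ](a) = χ(a₍₂₎) ψ(S(a₍₁₎) a₍₃₎)`. -/
def quantumBracket (χ ψ : Module.Dual K A) : Module.Dual K A :=
  LinearMap.mul' K K ∘ₗ TensorProduct.map χ ψ ∘ₗ adCoact K A

/-- The element `α ⋆ a = a₍₁₎ α(a₍₂₎)` for a functional `α`. -/
def starAct (α : Module.Dual K A) (a : A) : A :=
  TensorProduct.rid K A (α.lTensor A (Coalgebra.comul (R := K) a))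

/-- The data that a basis `θ` of left-invariant forms determines: the pairing `p` between the
forms and the quantum Lie algebra, the basis `χ` of the quantum Lie algebra dual to `θ`, the
functionals `f` with `θᵢ a = ∑ⱼ (f_{ij} ⋆ a) θⱼ`, and the elements `v` with
`Δ_R θᵢ = ∑ⱼ θⱼ ⊗ v_{ji}`. -/
structure BicovariantCalculus.IsDualFrame (C : BicovariantCalculus K A Γ) (θ : Fin 4 → Γ)
    (p : Γ →ₗ[K] C.quantumLieAlgebra →ₗ[K] K)
    (χ : Module.Basis (Fin 4) K C.quantumLieAlgebra)
    (f : Fin 4 → Fin 4 → Module.Dual K A) (v : Fin 4 → Fin 4 → A) : Prop where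
  pair_smul : ∀ (a : A) (ω : Γ) (ψ : C.quantumLieAlgebra),
    p (a • ω) ψ = Coalgebra.counit (R := K) a * p ω ψ
  pair_d : ∀ (a : A) (ψ : C.quantumLieAlgebra), p (C.d a) ψ = (ψ : Module.Dual K A) a
  dual : ∀ i j, p (θ i) (χ j) = if i = j then 1 else 0
  comm : ∀ (a : A) (i : Fin 4), MulOpposite.op a • θ i = ∑ j, starAct (f i j) a • θ j
  coact : ∀ i, C.coactR (θ i) = ∑ j, θ j ⊗ₜ[K] v j i

/-- The component `Λ_{st,ik} = f_{sk}(v_{it})` of the braiding `Λ(θₛ ⊗ θₜ) = ∑ Λ_{st,ik} θᵢ ⊗ θₖ`,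
as a function of `s`, `t`, `i`, `k`. -/
def braiding (f : Fin 4 → Fin 4 → Module.Dual K A) (v : Fin 4 → Fin 4 → A)
    (s t i k : Fin 4) : K :=
  f s k (v i t)

end Calculus

/-- The quantum commutator `Xᵢ Xₖ - ∑ Λ_{st,ik} Xₛ Xₜ`. -/
def quantumCommutator {K B : Type*} [Field K] [Ring B] [Algebra K B]
    (Λ : Fin 4 → Fin 4 → Fin 4 → Fin 4 → K) (X : Fin 4 → B) (i k : Fin 4) : B :=
  X i * X k - ∑ s, ∑ t, Λ s t i k • (X s * X t)

section Jordanian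

variable {K Γ : Type*} [Field K] {h g : K} [AddCommGroup Γ] [Module K Γ]
  [Module (JordanianGL h g) Γ] [Module (JordanianGL h g)ᵐᵒᵖ Γ]
  [IsScalarTower K (JordanianGL h g) Γ] [IsScalarTower K (JordanianGL h g)ᵐᵒᵖ Γ]
  [SMulCommClass (JordanianGL h g) (JordanianGL h g)ᵐᵒᵖ Γ]

namespace BicovariantCalculus

/-- The left-invariant forms `θ₁ = P(da)`, `θ₂ = P(db)`, `θ₃ = P(dc)`, `θ₄ = P(dd)`. -/
def theta (C : BicovariantCalculus K (JordanianGL h g) Γ) : Fin 4 → Γ :=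
  ![C.invProj (C.d (.gen h g .a)), C.invProj (C.d (.gen h g .b)),
    C.invProj (C.d (.gen h g .c)), C.invProj (C.d (.gen h g .d))]

/-- `C` is a 4D calculus with the given `ABCD` matrices: `θ₁, θ₂, θ₃, θ₄` is a basis of the space
of left-invariant forms, and the commutation relations of these forms with the generators are
`θᵢ a = ∑ⱼ (a Aᵢⱼ + b Cᵢⱼ) θⱼ`, `θᵢ b = ∑ⱼ (a Bᵢⱼ + b Dᵢⱼ) θⱼ`,
`θᵢ c = ∑ⱼ (c Aᵢⱼ + d Cᵢⱼ) θⱼ`, `θᵢ d = ∑ⱼ (c Bᵢⱼ + d Dᵢⱼ) θⱼ`. -/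
structure HasABCD (C : BicovariantCalculus K (JordanianGL h g) Γ)
    (A B C' D : Matrix (Fin 4) (Fin 4) K) : Prop where
  linearIndependent : LinearIndependent K C.theta
  span_eq : Submodule.span K (Set.range C.theta) = C.leftInvariants
  comm_a : ∀ i, MulOpposite.op (JordanianGL.gen h g .a) • C.theta i =
    ∑ j, (A i j • JordanianGL.gen h g .a + C' i j • JordanianGL.gen h g .b) • C.theta j
  comm_b : ∀ i, MulOpposite.op (JordanianGL.gen h g .b) • C.theta i =
    ∑ j, (B i j • JordanianGL.gen h g .a + D i j • JordanianGL.gen h g .b) • C.theta j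
  comm_c : ∀ i, MulOpposite.op (JordanianGL.gen h g .c) • C.theta i =
    ∑ j, (A i j • JordanianGL.gen h g .c + C' i j • JordanianGL.gen h g .d) • C.theta j
  comm_d : ∀ i, MulOpposite.op (JordanianGL.gen h g .d) • C.theta i =
    ∑ j, (B i j • JordanianGL.gen h g .c + D i j • JordanianGL.gen h g .d) • C.theta j

/-- `C` is the calculus with parameter `z` in the first family of 4D calculi. -/
def IsFamily₁ (C : BicovariantCalculus K (JordanianGL h g) Γ) (z : K) : Prop :=
  C.HasABCD
    !![(3 * z + 2) / 2, 0, (-(3 * h + g) * z - 2 * h) / 2, -z / 2;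
       h * (z + 1), z + 1, -h ^ 2 * (z + 1), -h * (z + 1);
       0, 0, z + 1, 0;
       z / 2, 0, ((h - g) * z + 2 * h) / 2, (z + 2) / 2]
    !![0, z, h * (h + g) * (z + 1), 0;
       0, (h + g) * (z + 1), -h * g * (h + g) * (z + 1), 0;
       0, 0, -(h + g) * (z + 1), 0;
       0, z, g * (h + g) * (z + 1), 0]
    !![0, 0, z, 0;
       0, 0, 0, 0;
       0, 0, 0, 0;
       0, 0, z, 0]
    !![(z + 2) / 2, 0, (-(h - g) * z + 2 * g) / 2, z / 2;
       -g * (z + 1), z + 1, -g ^ 2 * (z + 1), g * (z + 1);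
       0, 0, z + 1, 0;
       -z / 2, 0, (-(h + 3 * g) * z - 2 * g) / 2, (3 * z + 2) / 2]

/-- `C` is the calculus with parameter `z` in the second family of 4D calculi. -/
def IsFamily₂ (C : BicovariantCalculus K (JordanianGL h g) Γ) (z : K) : Prop :=
  C.HasABCD
    !![(z + 2) / 2, 0, ((h + g) * z - 2 * h) / 2, z / 2;
       h * (z + 1), 1, h * ((h + g) * z - h), h * (z - 1);
       0, 0, 1, 0;
       -z / 2, 0, (-(h + g) * z + 2 * h) / 2, (-z + 2) / 2]
    !![-h * z, 0, h * (h + g) * (1 - z), -h * z;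
       h * g * z, h + g, h * g * (h + g) * (z - 1), g * h * z;
       z, 0, (h + g) * (z - 1), z;
       -g * z, 0, g * (h + g) * (1 - z), -g * z]
    !![0, 0, 0, 0;
       z, 0, (h + g) * z, z;
       0, 0, 0, 0;
       0, 0, 0, 0]
    !![(-z + 2) / 2, 0, (-(h + g) * z + 2 * g) / 2, -z / 2;
       g * (z - 1), 1, g * ((h + g) * z - g), g * (z + 1);
       0, 0, 1, 0;
       z / 2, 0, ((h + g) * z - 2 * g) / 2, (z + 2) / 2]

/-- `C` is the calculus with parameter `z` in the third family of 4D calculi. -/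
def IsFamily₃ (C : BicovariantCalculus K (JordanianGL h g) Γ) (z : K) : Prop :=
  C.HasABCD
    !![(z + 2) / 2, 0, ((h + g) * z - 2 * h) / 2, z / 2;
       h, 1, -h ^ 2, -h;
       0, 0, 1, 0;
       z / 2, 0, ((h + g) * z + 2 * h) / 2, (z + 2) / 2]
    !![0, 0, h * (h + g), 0;
       0, h + g, -h * g * (h + g), 0;
       0, 0, -(h + g), 0;
       0, 0, g * (h + g), 0]
    !![0, 0, 0, 0;
       0, 0, 0, 0;
       0, 0, 0, 0;
       0, 0, 0, 0]
    !![(z + 2) / 2, 0, ((h + g) * z + 2 * g) / 2, z / 2;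
       -g, 1, -g ^ 2, g;
       0, 0, 1, 0;
       z / 2, 0, ((h + g) * z - 2 * g) / 2, (z + 2) / 2]

end BicovariantCalculus

end Jordanian

section Tables

/-- The quantum Lie brackets of `L₁`: the entry in row `i` and column `k` is `[χᵢ, χₖ]`. -/
def bracketTable₁ {K V : Type*} [Field K] [AddCommGroup V] [Module K V] (h g z : K)
    (χ₁ χ₂ χ₃ χ₄ : V) : Fin 4 → Fin 4 → V :=
  ![![
      -- row 1, column 1
      0,
      -- row 1, column 2
      (1 / (z + 1)) • χ₂,
      -- row 1, column 3
      -((1 / (z + 1)) • χ₃) + ((h + g) / (z + 1)) • χ₄,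
      -- row 1, column 4
      0],
    ![
      -- row 2, column 1
      -((1 / (z + 1)) • χ₂),
      -- row 2, column 2
      0,
      -- row 2, column 3
      (1 / (z + 1)) • χ₁ - ((h + g) / (z + 1)) • χ₂ - (1 / (z + 1)) • χ₄,
      -- row 2, column 4
      (1 / (z + 1)) • χ₂],
    ![
      -- row 3, column 1
      -(((h + g) / (z + 1)) • χ₁) + (1 / (z + 1)) • χ₃,
      -- row 3, column 2
      -((1 / (z + 1)) • χ₁) - ((h + g) / (z + 1)) • χ₂ + (1 / (z + 1)) • χ₄,
      -- row 3, column 3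
      ((h + g) ^ 2 / (z + 1)) • χ₁ - (2 * (h + g) / (z + 1)) • χ₃ + ((h + g) ^ 2 / (z + 1)) • χ₄,
      -- row 3, column 4
      ((h + g) / (z + 1)) • χ₁ - (1 / (z + 1)) • χ₃],
    ![
      -- row 4, column 1
      0,
      -- row 4, column 2
      -((1 / (z + 1)) • χ₂),
      -- row 4, column 3
      (1 / (z + 1)) • χ₃ - ((h + g) / (z + 1)) • χ₄,
      -- row 4, column 4
      0]]

/-- The quantum commutators of `L₁`: the entry in row `i` and column `k` is
`χᵢ χₖ - ∑ Λ_{st,ik} χₛ χₜ`. -/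
def commutatorTable₁ {K B : Type*} [Field K] [Ring B] [Algebra K B] (h g z : K)
    (X₁ X₂ X₃ X₄ : B) : Fin 4 → Fin 4 → B :=
  ![![
      -- row 1, column 1
      0,
      -- row 1, column 2
      X₁ * X₂ - ((z / (z + 1)) • (X₁ * X₂) + X₂ * X₁ + (h + g) • (X₂ * X₂)
        + (z / (z + 1)) • (X₄ * X₂)),
      -- row 1, column 3
      X₁ * X₃ - (-((z / (z + 1)) • (X₁ * X₃)) + (z * (h + g) / (z + 1)) • (X₁ * X₄) + X₃ * X₁
        - (h + g) • (X₃ * X₂) + ((h + g) ^ 2) • (X₄ * X₂) - (z / (z + 1)) • (X₄ * X₃)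
        + (z * (h + g) / (z + 1)) • (X₄ * X₄)),
      -- row 1, column 4
      X₁ * X₄ - X₄ * X₁],
    ![
      -- row 2, column 1
      X₂ * X₁ - ((1 / (z + 1)) • (X₁ * X₂) - (h + g) • (X₂ * X₂) - (z / (z + 1)) • (X₄ * X₂)),
      -- row 2, column 2
      0,
      -- row 2, column 3
      X₂ * X₃ - ((z / (z + 1)) • (X₁ * X₁) + ((h + g) / (z + 1)) • (X₁ * X₂)
        - (z / (z + 1)) • (X₁ * X₄) - ((h + g) ^ 2) • (X₂ * X₂) + X₃ * X₂
        + (z / (z + 1)) • (X₄ * X₁) - ((h + g) * (2 * z + 1) / (z + 1)) • (X₄ * X₂)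
        - (z / (z + 1)) • (X₄ * X₄)),
      -- row 2, column 4
      X₂ * X₄ - ((z / (z + 1)) • (X₁ * X₂) + (h + g) • (X₂ * X₂)
        + ((2 * z + 1) / (z + 1)) • (X₄ * X₂))],
    ![
      -- row 3, column 1
      X₃ * X₁ - (-((z * (h + g) / (z + 1)) • (X₁ * X₁)) + ((2 * z + 1) / (z + 1)) • (X₁ * X₃)
        - ((h + g) ^ 2) • (X₂ * X₁) + (h + g) • (X₂ * X₃) - (z * (h + g) / (z + 1)) • (X₄ * X₁)
        + (z / (z + 1)) • (X₄ * X₃)),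
      -- row 3, column 2
      X₃ * X₂ - (-((z / (z + 1)) • (X₁ * X₁)) - (z * (h + g) / (z + 1)) • (X₁ * X₂)
        + (z / (z + 1)) • (X₁ * X₄) - (h + g) • (X₂ * X₁) - ((h + g) ^ 2) • (X₂ * X₂) + X₂ * X₃
        + (h + g) • (X₂ * X₄) - (z / (z + 1)) • (X₄ * X₁) - (z * (h + g) / (z + 1)) • (X₄ * X₂)
        + (z / (z + 1)) • (X₄ * X₄)),
      -- row 3, column 3
      X₃ * X₃ - ((z * (h + g) ^ 2 / (z + 1)) • (X₁ * X₁)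
        - ((h + g) * (3 * z + 1) / (z + 1)) • (X₁ * X₃)
        + ((h + g) ^ 2 * (2 * z + 1) / (z + 1)) • (X₁ * X₄) + ((h + g) ^ 3) • (X₂ * X₁)
        - ((h + g) ^ 2) • (X₂ * X₃) + (h + g) • (X₃ * X₁) - ((h + g) ^ 2) • (X₃ * X₂) + X₃ * X₃
        - (h + g) • (X₃ * X₄) - ((h + g) ^ 2 / (z + 1)) • (X₄ * X₁) + ((h + g) ^ 3) • (X₄ * X₂)
        - ((h + g) * (z - 1) / (z + 1)) • (X₄ * X₃) + (z * (h + g) ^ 2 / (z + 1)) • (X₄ * X₄)),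
      -- row 3, column 4
      X₃ * X₄ - ((z * (h + g) / (z + 1)) • (X₁ * X₁) - (z / (z + 1)) • (X₁ * X₃)
        + ((h + g) ^ 2) • (X₂ * X₁) - (h + g) • (X₂ * X₃) + (z * (h + g) / (z + 1)) • (X₄ * X₁)
        + (1 / (z + 1)) • (X₄ * X₃))],
    ![
      -- row 4, column 1
      X₄ * X₁ - X₁ * X₄,
      -- row 4, column 2
      X₄ * X₂ - (-((z / (z + 1)) • (X₁ * X₂)) - (h + g) • (X₂ * X₂) + X₂ * X₄
        - (z / (z + 1)) • (X₄ * X₂)),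
      -- row 4, column 3
      X₄ * X₃ - ((z / (z + 1)) • (X₁ * X₃) - (z * (h + g) / (z + 1)) • (X₁ * X₄)
        + (h + g) • (X₃ * X₂) + X₃ * X₄ - ((h + g) ^ 2) • (X₄ * X₂) + (z / (z + 1)) • (X₄ * X₃)
        - (z * (h + g) / (z + 1)) • (X₄ * X₄)),
      -- row 4, column 4
      0]]

/-- The quantum Lie brackets of `L₂`: the entry in row `i` and column `k` is `[χᵢ, χₖ]`. -/
def bracketTable₂ {K V : Type*} [Field K] [AddCommGroup V] [Module K V] (h g z : K)
    (χ₁ χ₂ χ₃ χ₄ : V) : Fin 4 → Fin 4 → V :=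
  ![![
      -- row 1, column 1
      z • χ₁ - z • χ₄,
      -- row 1, column 2
      χ₂,
      -- row 1, column 3
      (z * (h + g)) • χ₁ - χ₃ - ((z - 1) * (h + g)) • χ₄,
      -- row 1, column 4
      z • χ₁ - z • χ₄],
    ![
      -- row 2, column 1
      (2 * z - 1) • χ₂,
      -- row 2, column 2
      0,
      -- row 2, column 3
      χ₁ + ((2 * z - 1) * (h + g)) • χ₂ - χ₄,
      -- row 2, column 4
      (2 * z + 1) • χ₂],
    ![
      -- row 3, column 1
      -(((z + 1) * (h + g)) • χ₁) + (2 * z + 1) • χ₃ - (z * (h + g)) • χ₄,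
      -- row 3, column 2
      -χ₁ - (h + g) • χ₂ + χ₄,
      -- row 3, column 3
      -(((z - 1) * (h + g) ^ 2) • χ₁) + (2 * (z - 1) * (h + g)) • χ₃
        - ((z - 1) * (h + g) ^ 2) • χ₄,
      -- row 3, column 4
      -(((z - 1) * (h + g)) • χ₁) + (2 * z - 1) • χ₃ - (z * (h + g)) • χ₄],
    ![
      -- row 4, column 1
      -(z • χ₁) + z • χ₄,
      -- row 4, column 2
      -χ₂,
      -- row 4, column 3
      -((z * (h + g)) • χ₁) + χ₃ + ((z - 1) * (h + g)) • χ₄,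
      -- row 4, column 4
      -(z • χ₁) + z • χ₄]]

/-- The quantum commutators of `L₂`: the entry in row `i` and column `k` is
`χᵢ χₖ - ∑ Λ_{st,ik} χₛ χₜ`. -/
def commutatorTable₂ {K B : Type*} [Field K] [Ring B] [Algebra K B] (h g z : K)
    (X₁ X₂ X₃ X₄ : B) : Fin 4 → Fin 4 → B :=
  ![![
      -- row 1, column 1
      X₁ * X₁ - (X₁ * X₁ + (z * (h + g)) • (X₂ * X₁) - z • (X₂ * X₃) + z • (X₃ * X₂)
        - (z * (h + g)) • (X₄ * X₂)),
      -- row 1, column 2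
      X₁ * X₂ - (X₂ * X₁ + (h + g) • (X₂ * X₂)),
      -- row 1, column 3
      X₁ * X₃ - ((z * (h + g) ^ 2) • (X₂ * X₁) - (z * (h + g)) • (X₂ * X₃) + X₃ * X₁
        + ((h + g) * (z - 1)) • (X₃ * X₂) - ((h + g) ^ 2 * (z - 1)) • (X₄ * X₂)),
      -- row 1, column 4
      X₁ * X₄ - ((z * (h + g)) • (X₂ * X₁) - z • (X₂ * X₃) + z • (X₃ * X₂) + X₄ * X₁
        - (z * (h + g)) • (X₄ * X₂))],
    ![
      -- row 2, column 1
      X₂ * X₁ - (-((z - 1) • (X₁ * X₂)) + z • (X₂ * X₁) + ((h + g) * (2 * z - 1)) • (X₂ * X₂)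
        - z • (X₂ * X₄) + z • (X₄ * X₂)),
      -- row 2, column 2
      0,
      -- row 2, column 3
      X₂ * X₃ - (-(((h + g) * (z - 1)) • (X₁ * X₂)) + (z * (h + g)) • (X₂ * X₁)
        + ((h + g) ^ 2 * (2 * z - 1)) • (X₂ * X₂) - (z * (h + g)) • (X₂ * X₄) + X₃ * X₂
        + ((h + g) * (z - 1)) • (X₄ * X₂)),
      -- row 2, column 4
      X₂ * X₄ - (-(z • (X₁ * X₂)) + z • (X₂ * X₁) + ((h + g) * (2 * z + 1)) • (X₂ * X₂)
        - z • (X₂ * X₄) + (z + 1) • (X₄ * X₂))],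
    ![
      -- row 3, column 1
      X₃ * X₁ - ((z + 1) • (X₁ * X₃) - (z * (h + g)) • (X₁ * X₄)
        - ((h + g) ^ 2 * (z + 1)) • (X₂ * X₁) + ((h + g) * (z + 1)) • (X₂ * X₃) - z • (X₃ * X₁)
        + (z * (h + g)) • (X₃ * X₂) + z • (X₃ * X₄) + (z * (h + g)) • (X₄ * X₁)
        - (z * (h + g) ^ 2) • (X₄ * X₂) - z • (X₄ * X₃)),
      -- row 3, column 2
      X₃ * X₂ - (-((h + g) • (X₂ * X₁)) - ((h + g) ^ 2) • (X₂ * X₂) + X₂ * X₃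
        + (h + g) • (X₂ * X₄)),
      -- row 3, column 3
      X₃ * X₃ - (((h + g) * (z - 1)) • (X₁ * X₃) - ((h + g) ^ 2 * (z - 1)) • (X₁ * X₄)
        - ((h + g) ^ 3 * (z - 1)) • (X₂ * X₁) + ((h + g) ^ 2 * (z - 1)) • (X₂ * X₃)
        - ((h + g) * (z - 1)) • (X₃ * X₁) + ((h + g) ^ 2 * (z - 1)) • (X₃ * X₂) + X₃ * X₃
        + ((h + g) * (z - 1)) • (X₃ * X₄) + ((h + g) ^ 2 * (z - 1)) • (X₄ * X₁)
        - ((h + g) ^ 3 * (z - 1)) • (X₄ * X₂) - ((h + g) * (z - 1)) • (X₄ * X₃)),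
      -- row 3, column 4
      X₃ * X₄ - (z • (X₁ * X₃) - (z * (h + g)) • (X₁ * X₄) - ((h + g) ^ 2 * (z - 1)) • (X₂ * X₁)
        + ((h + g) * (z - 1)) • (X₂ * X₃) - z • (X₃ * X₁) + (z * (h + g)) • (X₃ * X₂)
        + z • (X₃ * X₄) + (z * (h + g)) • (X₄ * X₁) - (z * (h + g) ^ 2) • (X₄ * X₂)
        - (z - 1) • (X₄ * X₃))],
    ![
      -- row 4, column 1
      X₄ * X₁ - (X₁ * X₄ - (z * (h + g)) • (X₂ * X₁) + z • (X₂ * X₃) - z • (X₃ * X₂)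
        + (z * (h + g)) • (X₄ * X₂)),
      -- row 4, column 2
      X₄ * X₂ - (-((h + g) • (X₂ * X₂)) + X₂ * X₄),
      -- row 4, column 3
      X₄ * X₃ - (-((z * (h + g) ^ 2) • (X₂ * X₁)) + (z * (h + g)) • (X₂ * X₃)
        - ((h + g) * (z - 1)) • (X₃ * X₂) + X₃ * X₄ + ((h + g) ^ 2 * (z - 1)) • (X₄ * X₂)),
      -- row 4, column 4
      X₄ * X₄ - (-((z * (h + g)) • (X₂ * X₁)) + z • (X₂ * X₃) - z • (X₃ * X₂)
        + (z * (h + g)) • (X₄ * X₂) + X₄ * X₄)]]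

/-- The quantum Lie brackets of `L₃`: the entry in row `i` and column `k` is `[χᵢ, χₖ]`. -/
def bracketTable₃ {K V : Type*} [Field K] [AddCommGroup V] [Module K V] (h g : K)
    (χ₁ χ₂ χ₃ χ₄ : V) : Fin 4 → Fin 4 → V :=
  ![![
      -- row 1, column 1
      0,
      -- row 1, column 2
      χ₂,
      -- row 1, column 3
      -χ₃ + (h + g) • χ₄,
      -- row 1, column 4
      0],
    ![
      -- row 2, column 1
      -χ₂,
      -- row 2, column 2
      0,
      -- row 2, column 3
      χ₁ - (h + g) • χ₂ - χ₄,
      -- row 2, column 4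
      χ₂],
    ![
      -- row 3, column 1
      -((h + g) • χ₁) + χ₃,
      -- row 3, column 2
      -χ₁ - (h + g) • χ₂ + χ₄,
      -- row 3, column 3
      ((h + g) ^ 2) • χ₁ - (2 * (h + g)) • χ₃ + ((h + g) ^ 2) • χ₄,
      -- row 3, column 4
      (h + g) • χ₁ - χ₃],
    ![
      -- row 4, column 1
      0,
      -- row 4, column 2
      -χ₂,
      -- row 4, column 3
      χ₃ - (h + g) • χ₄,
      -- row 4, column 4
      0]]

/-- The quantum commutators of `L₃`: the entry in row `i` and column `k` is
`χᵢ χₖ - ∑ Λ_{st,ik} χₛ χₜ`. -/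
def commutatorTable₃ {K B : Type*} [Field K] [Ring B] [Algebra K B] (h g : K)
    (X₁ X₂ X₃ X₄ : B) : Fin 4 → Fin 4 → B :=
  ![![
      -- row 1, column 1
      0,
      -- row 1, column 2
      X₁ * X₂ - (X₂ * X₁ + (h + g) • (X₂ * X₂)),
      -- row 1, column 3
      X₁ * X₃ - (X₃ * X₁ - (h + g) • (X₃ * X₂) + ((h + g) ^ 2) • (X₄ * X₂)),
      -- row 1, column 4
      X₁ * X₄ - X₄ * X₁],
    ![
      -- row 2, column 1
      X₂ * X₁ - (X₁ * X₂ - (h + g) • (X₂ * X₂)),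
      -- row 2, column 2
      0,
      -- row 2, column 3
      X₂ * X₃ - ((h + g) • (X₁ * X₂) - ((h + g) ^ 2) • (X₂ * X₂) + X₃ * X₂ - (h + g) • (X₄ * X₂)),
      -- row 2, column 4
      X₂ * X₄ - ((h + g) • (X₂ * X₂) + X₄ * X₂)],
    ![
      -- row 3, column 1
      X₃ * X₁ - (X₁ * X₃ - ((h + g) ^ 2) • (X₂ * X₁) + (h + g) • (X₂ * X₃)),
      -- row 3, column 2
      X₃ * X₂ - (-((h + g) • (X₂ * X₁)) - ((h + g) ^ 2) • (X₂ * X₂) + X₂ * X₃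
        + (h + g) • (X₂ * X₄)),
      -- row 3, column 3
      X₃ * X₃ - (-((h + g) • (X₁ * X₃)) + ((h + g) ^ 2) • (X₁ * X₄) + ((h + g) ^ 3) • (X₂ * X₁)
        - ((h + g) ^ 2) • (X₂ * X₃) + (h + g) • (X₃ * X₁) - ((h + g) ^ 2) • (X₃ * X₂) + X₃ * X₃
        - (h + g) • (X₃ * X₄) - ((h + g) ^ 2) • (X₄ * X₁) + ((h + g) ^ 3) • (X₄ * X₂)
        + (h + g) • (X₄ * X₃)),
      -- row 3, column 4
      X₃ * X₄ - (((h + g) ^ 2) • (X₂ * X₁) - (h + g) • (X₂ * X₃) + X₄ * X₃)],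
    ![
      -- row 4, column 1
      X₄ * X₁ - X₁ * X₄,
      -- row 4, column 2
      X₄ * X₂ - (-((h + g) • (X₂ * X₂)) + X₂ * X₄),
      -- row 4, column 3
      X₄ * X₃ - ((h + g) • (X₃ * X₂) + X₃ * X₄ - ((h + g) ^ 2) • (X₄ * X₂)),
      -- row 4, column 4
      0]]

end Tables

end

/-! The argument separates general Hopf algebra theory from a finite computation.

General part. The projection `P` satisfies `P(aω) = ε(a) P(ω)` and `ω = ω_A P(ω_Γ)`, so every form
is determined by its invariant components, and `da = ∑ (χⱼ ⋆ a) θⱼ`. Applying `Δ_R` to this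
expansion and pairing with `χᵢ` gives the identity on which everything rests, `∑ₜ (χₜ ⋆ a) v_{it} =
χᵢ(a₍₁₎) a₍₂₎` (`sum_starAct_mul_v`). Multiplying it by the antipode yields `[χᵢ, β] = ∑ₜ β(v_{it})
χₜ` (`quantumBracket_eq_sum`). Applying `χₖ` to it, with the twisted Leibniz rule `χ_mul`, yields
`χᵢχₖ = ∑ f_{sk}(v_{it}) χₛχₜ + [χᵢ, χₖ]` (`quantumBracket_eq_quantumCommutator`).

The braiding. The map `x ↦ (f_{ij}(x))` is multiplicative and sends `a, b, c, d` to `A, B, C, D`.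
Applied to the key identity at the four matrix entries, it gives a linear system for the matrices of
the `v_{it}` whose coefficient matrix is the block matrix `(A B; C D)`. A left inverse of that block
matrix solves it, so every `Λ_{st,ik}` is an entry of a product of an inverse block with one of `A,
B, C, D` (`braiding_eq_blockBraiding`).

The brackets. Evaluation on `(a b; c d)` is an algebra map from the convolution algebra to the `2 ×
2` matrices, and it sends the `χⱼ` to the matrix units. A bracket lies in the span of the `χⱼ`, so
its coefficients are the entries of the same quantum commutator computed with matrix units
(`quantumBracket_eq_matrixUnit`).

What is left for each family is to exhibit the inverse blocks and to compare coefficients with the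
tables. Beyond the Hopf algebra axioms, only the coproduct and counit of the matrix entries enter
these computations; the defining relations and the formulas for the antipode do not. -/

set_option linter.unusedSectionVars false

noncomputable section

/-! ### Left-invariant forms of a bicovariant calculus -/

section GeneralCalculus

variable {K A Γ : Type*} [Field K] [Ring A] [HopfAlgebra K A] [AddCommGroup Γ] [Module K Γ]
  [Module A Γ] [Module Aᵐᵒᵖ Γ] [IsScalarTower K A Γ] [IsScalarTower K Aᵐᵒᵖ Γ]
  [SMulCommClass A Aᵐᵒᵖ Γ]

@[simp]
theorem lact_apply (a : A) (ω : Γ) : lact K A Γ a ω = a • ω := rfl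

@[simp]
theorem ract_apply (a : A) (ω : Γ) : ract K A Γ a ω = MulOpposite.op a • ω := rfl

@[simp]
theorem lactL_tmul (x y c : A) (ω : Γ) :
    lactL K A Γ (x ⊗ₜ y) (c ⊗ₜ ω) = (x * c) ⊗ₜ (y • ω) := rfl

@[simp]
theorem lactR_tmul (x y c : A) (ω : Γ) :
    lactR K A Γ (x ⊗ₜ y) (ω ⊗ₜ c) = (x • ω) ⊗ₜ (y * c) := rfl

theorem lactL_one (t : A ⊗[K] Γ) : lactL K A Γ 1 t = t := by
  induction t with
  | zero => simp only [map_zero]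
  | add s t hs ht => simp only [map_add, hs, ht]
  | tmul c ω => rw [Algebra.TensorProduct.one_def, lactL_tmul, one_mul, one_smul]

theorem lactL_mul (u w : A ⊗[K] A) (t : A ⊗[K] Γ) :
    lactL K A Γ (u * w) t = lactL K A Γ u (lactL K A Γ w t) := by
  induction t with
  | zero => simp only [map_zero]
  | add s t hs ht => simp only [map_add, hs, ht]
  | tmul c ω =>
    induction u with
    | zero => simp only [map_zero, zero_mul, LinearMap.zero_apply]
    | add s t hs ht => simp only [map_add, add_mul, LinearMap.add_apply, hs, ht]
    | tmul x y =>
      induction w with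
      | zero => simp only [map_zero, mul_zero, LinearMap.zero_apply]
      | add s t hs ht => simp only [map_add, mul_add, LinearMap.add_apply, hs, ht]
      | tmul x' y' => simp [mul_assoc, mul_smul]

variable (K A Γ) in
/-- The action of `A` on `A ⊗ Γ` through the coproduct. -/
def diagAct : A →ₐ[K] Module.End K (A ⊗[K] Γ) :=
  AlgHom.ofLinearMap (lactL K A Γ ∘ₗ Coalgebra.comul (R := K))
    (LinearMap.ext fun t => by
      simp only [LinearMap.comp_apply, Bialgebra.comul_one, lactL_one, Module.End.one_apply])
    (fun x y => LinearMap.ext fun t => by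
      simp only [LinearMap.comp_apply, Bialgebra.comul_mul, lactL_mul, Module.End.mul_apply])

@[simp]
theorem diagAct_apply (a : A) (t : A ⊗[K] Γ) :
    diagAct K A Γ a t = lactL K A Γ (Coalgebra.comul (R := K) a) t := rfl

/-- `α ⋆ a` as a linear map in `a`. -/
def starLin (α : Module.Dual K A) : A →ₗ[K] A :=
  (TensorProduct.rid K A).toLinearMap ∘ₗ α.lTensor A ∘ₗ Coalgebra.comul (R := K)

theorem starLin_apply (α : Module.Dual K A) (a : A) : starLin α a = starAct α a := rfl

/-- This is `ε(a₍₁₎) α(a₍₂₎) = α(a)`; it recovers a functional from its convolution operator when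
forms are paired with the dual basis. -/
theorem counit_starAct (α : Module.Dual K A) (a : A) :
    Coalgebra.counit (R := K) (starAct α a) = α a := by
  have key : ∀ u : A ⊗[K] A, Coalgebra.counit (R := K) (TensorProduct.rid K A (α.lTensor A u)) =
      α (TensorProduct.lid K A ((Coalgebra.counit (R := K) (A := A)).rTensor A u)) := by
    intro u
    induction u with
    | zero => simp only [map_zero]
    | add s t hs ht => simp only [map_add, hs, ht]
    | tmul x y => simp [mul_comm]
  rw [starAct, key, Coalgebra.rTensor_counit_comul, TensorProduct.lid_tmul, one_smul]

/-- In Sweedler notation, `S(a₍₁₎) a₍₂₎ α(a₍₃₎) = α(a) 1`. This is what strips the operator `χₜ ⋆`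
from the key identity in `quantumBracket_eq_sum`. -/
theorem sum_antipode_mul_starAct (α : Module.Dual K A) (a : A) :
    TensorProduct.lift (LinearMap.mul K A ∘ₗ HopfAlgebra.antipode K)
      ((starLin α).lTensor A (Coalgebra.comul (R := K) a)) = α a • 1 := by
  -- Sweedler computations here replace the coproduct by an arbitrary tensor, so that the identity
  -- can be checked on pure tensors; the inner `this` does the same for the second coproduct, after
  -- which the antipode axiom applies.
  have key : ∀ t : A ⊗[K] A, TensorProduct.lift (LinearMap.mul K A ∘ₗ HopfAlgebra.antipode K)
      (((TensorProduct.rid K A).toLinearMap ∘ₗ α.lTensor A).lTensor A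
        (TensorProduct.assoc K A A A ((Coalgebra.comul (R := K) (A := A)).rTensor A t))) =
      α (TensorProduct.lid K A ((Coalgebra.counit (R := K) (A := A)).rTensor A t)) • 1 := by
    intro t
    induction t with
    | zero => simp only [map_zero, zero_smul]
    | add s t hs ht => simp only [map_add, hs, ht, add_smul]
    | tmul c b =>
      have : ∀ u : A ⊗[K] A, TensorProduct.lift (LinearMap.mul K A ∘ₗ HopfAlgebra.antipode K)
          (((TensorProduct.rid K A).toLinearMap ∘ₗ α.lTensor A).lTensor A
            (TensorProduct.assoc K A A A (u ⊗ₜ b))) =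
          α b • LinearMap.mul' K A ((HopfAlgebra.antipode K (A := A)).rTensor A u) := by
        intro u
        induction u with
        | zero => simp only [map_zero, TensorProduct.zero_tmul, smul_zero]
        | add s t hs ht => simp only [map_add, TensorProduct.add_tmul, smul_add, hs, ht]
        | tmul x y => simp
      rw [LinearMap.rTensor_tmul, this, HopfAlgebra.mul_antipode_rTensor_comul_apply]
      simp [Algebra.algebraMap_eq_smul_one, smul_smul, mul_comm]
  have e : (starLin α).lTensor A (Coalgebra.comul (R := K) a) =
      ((TensorProduct.rid K A).toLinearMap ∘ₗ α.lTensor A).lTensor A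
        ((Coalgebra.comul (R := K) (A := A)).lTensor A (Coalgebra.comul (R := K) a)) := by
    rw [← LinearMap.lTensor_comp_apply]; rfl
  rw [e, ← Coalgebra.coassoc_apply, key, Coalgebra.rTensor_counit_comul, TensorProduct.lid_tmul,
    one_smul]

namespace BicovariantCalculus

variable (C : BicovariantCalculus K A Γ)

theorem d_one : C.d 1 = 0 := by
  have := C.leibniz 1 1
  rw [mul_one, MulOpposite.op_one, one_smul, one_smul] at this
  exact left_eq_add.mp this

/-- Since `S` is antimultiplicative, `S(a₍₁₎ ω_A) a₍₂₎ ω_Γ = S(ω_A) (S(a₍₁₎) a₍₂₎) ω_Γ`. -/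
theorem invProj_smul (a : A) (ω : Γ) :
    C.invProj (a • ω) = Coalgebra.counit (R := K) a • C.invProj ω := by
  have key : ∀ t : A ⊗[K] Γ, TensorProduct.lift (lact K A Γ ∘ₗ HopfAlgebra.antipode K)
      (lactL K A Γ (Coalgebra.comul (R := K) a) t) =
      Coalgebra.counit (R := K) a •
        TensorProduct.lift (lact K A Γ ∘ₗ HopfAlgebra.antipode K) t := by
    intro t
    induction t with
    | zero => simp only [map_zero, smul_zero]
    | add s t hs ht => simp only [map_add, hs, ht, smul_add]
    | tmul c η =>
      have : ∀ u : A ⊗[K] A, TensorProduct.lift (lact K A Γ ∘ₗ HopfAlgebra.antipode K)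
          (lactL K A Γ u (c ⊗ₜ η)) = HopfAlgebra.antipode K c •
            LinearMap.mul' K A ((HopfAlgebra.antipode K (A := A)).rTensor A u) • η := by
        intro u
        induction u with
        | zero => simp only [map_zero, LinearMap.zero_apply, zero_smul, smul_zero]
        | add s t hs ht => simp only [map_add, LinearMap.add_apply, hs, ht, add_smul, smul_add]
        | tmul x y => simp [HopfAlgebra.antipode_mul_antidistrib, mul_smul]
      rw [this, HopfAlgebra.mul_antipode_rTensor_comul_apply, algebraMap_smul,
        TensorProduct.lift.tmul, LinearMap.comp_apply, lact_apply, smul_comm]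
  simp only [invProj, LinearMap.comp_apply, coactL_smul, key]

/-- By coassociativity of `Δ_L`, the antipode in `ω_A P(ω_Γ)` meets its neighbouring leg and
cancels. Forms are thus rebuilt from their invariant projections; all expansions in the `θⱼ` come
from here. -/
theorem lift_lact_invProj (ω : Γ) :
    TensorProduct.lift (lact K A Γ) (C.invProj.lTensor A (C.coactL ω)) = ω := by
  have key : ∀ t : A ⊗[K] Γ, TensorProduct.lift (lact K A Γ)
      ((TensorProduct.lift (lact K A Γ ∘ₗ HopfAlgebra.antipode K)).lTensor A
        (TensorProduct.assoc K A A Γ ((Coalgebra.comul (R := K) (A := A)).rTensor Γ t))) =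
      TensorProduct.lid K Γ ((Coalgebra.counit (R := K) (A := A)).rTensor Γ t) := by
    intro t
    induction t with
    | zero => simp only [map_zero]
    | add s t hs ht => simp only [map_add, hs, ht]
    | tmul c η =>
      have : ∀ u : A ⊗[K] A, TensorProduct.lift (lact K A Γ)
          ((TensorProduct.lift (lact K A Γ ∘ₗ HopfAlgebra.antipode K)).lTensor A
            (TensorProduct.assoc K A A Γ (u ⊗ₜ η))) =
            LinearMap.mul' K A ((HopfAlgebra.antipode K (A := A)).lTensor A u) • η := by
        intro u
        induction u with
        | zero => simp only [map_zero, TensorProduct.zero_tmul, zero_smul]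
        | add s t hs ht => simp only [map_add, TensorProduct.add_tmul, hs, ht, add_smul]
        | tmul x y => simp [mul_smul]
      rw [LinearMap.rTensor_tmul, this, HopfAlgebra.mul_antipode_lTensor_comul_apply,
        algebraMap_smul]
      simp
  rw [invProj, LinearMap.lTensor_comp, LinearMap.comp_apply, C.coactL_coassoc, key,
    C.coactL_counit]

/-- Convolution with an action of `A` along the left coaction can be undone with the antipode. -/
theorem lift_antipode_lTensor {V : Type*} [AddCommGroup V] [Module K V]
    (ρ : A →ₐ[K] Module.End K V) (G : Γ →ₗ[K] V) (ω : Γ) :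
    TensorProduct.lift (ρ.toLinearMap ∘ₗ HopfAlgebra.antipode K)
      ((TensorProduct.lift ρ.toLinearMap ∘ₗ G.lTensor A ∘ₗ C.coactL).lTensor A (C.coactL ω)) =
      G ω := by
  have key : ∀ t : A ⊗[K] Γ, TensorProduct.lift (ρ.toLinearMap ∘ₗ HopfAlgebra.antipode K)
      ((TensorProduct.lift ρ.toLinearMap ∘ₗ G.lTensor A).lTensor A
        (TensorProduct.assoc K A A Γ ((Coalgebra.comul (R := K) (A := A)).rTensor Γ t))) =
      G (TensorProduct.lid K Γ ((Coalgebra.counit (R := K) (A := A)).rTensor Γ t)) := by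
    intro t
    induction t with
    | zero => simp only [map_zero]
    | add s t hs ht => simp only [map_add, hs, ht]
    | tmul c η =>
      have : ∀ u : A ⊗[K] A, TensorProduct.lift (ρ.toLinearMap ∘ₗ HopfAlgebra.antipode K)
          ((TensorProduct.lift ρ.toLinearMap ∘ₗ G.lTensor A).lTensor A
            (TensorProduct.assoc K A A Γ (u ⊗ₜ η))) =
          ρ (LinearMap.mul' K A ((HopfAlgebra.antipode K (A := A)).rTensor A u)) (G η) := by
        intro u
        induction u with
        | zero => simp only [map_zero, TensorProduct.zero_tmul, LinearMap.zero_apply]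
        | add s t hs ht => simp only [map_add, TensorProduct.add_tmul, hs, ht, LinearMap.add_apply]
        | tmul x y => simp
      rw [LinearMap.rTensor_tmul, this, HopfAlgebra.mul_antipode_rTensor_comul_apply,
        AlgHom.commutes]
      simp
  rw [← LinearMap.comp_assoc, LinearMap.lTensor_comp, LinearMap.comp_apply, C.coactL_coassoc, key,
    C.coactL_counit]

/-- A uniqueness argument that needs no formula for `Δ(S(a))`. Both sides, as maps `G : Γ → A ⊗ Γ`,
solve `Δ(ω_A) G(ω_Γ) = Δ_L(ω)`, and by `lift_antipode_lTensor` this equation determines `G`. -/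
theorem coactL_invProj (ω : Γ) : C.coactL (C.invProj ω) = 1 ⊗ₜ C.invProj ω := by
  -- For `G = Δ_L ∘ P`: left linearity of `Δ_L` turns the sum into `Δ_L(ω_A P(ω_Γ))`.
  have e₁ : TensorProduct.lift (diagAct K A Γ).toLinearMap ∘ₗ
      (C.coactL ∘ₗ C.invProj).lTensor A ∘ₗ C.coactL = C.coactL := by
    ext ω
    have key : ∀ t : A ⊗[K] Γ, TensorProduct.lift (diagAct K A Γ).toLinearMap
        ((C.coactL ∘ₗ C.invProj).lTensor A t) =
        C.coactL (TensorProduct.lift (lact K A Γ) (C.invProj.lTensor A t)) := by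
      intro t
      induction t with
      | zero => simp only [map_zero]
      | add s t hs ht => simp only [map_add, hs, ht]
      | tmul c η => simp [coactL_smul]
    rw [LinearMap.comp_apply, LinearMap.comp_apply, key, lift_lact_invProj]
  -- For `G = 1 ⊗ P`: coassociativity moves the reconstruction `ω_A P(ω_Γ)` into the second leg of
  -- `Δ_L(ω)`.
  have e₂ : TensorProduct.lift (diagAct K A Γ).toLinearMap ∘ₗ
      (TensorProduct.mk K A Γ 1 ∘ₗ C.invProj).lTensor A ∘ₗ C.coactL = C.coactL := by
    ext ω
    have key : ∀ t : A ⊗[K] Γ, TensorProduct.lift (diagAct K A Γ).toLinearMap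
        ((TensorProduct.mk K A Γ 1 ∘ₗ C.invProj).lTensor A t) =
        (TensorProduct.lift (lact K A Γ) ∘ₗ C.invProj.lTensor A).lTensor A
          (TensorProduct.assoc K A A Γ ((Coalgebra.comul (R := K) (A := A)).rTensor Γ t)) := by
      intro t
      induction t with
      | zero => simp only [map_zero]
      | add s t hs ht => simp only [map_add, hs, ht]
      | tmul c η =>
        have : ∀ u : A ⊗[K] A, lactL K A Γ u (1 ⊗ₜ C.invProj η) =
            (TensorProduct.lift (lact K A Γ) ∘ₗ C.invProj.lTensor A).lTensor A
              (TensorProduct.assoc K A A Γ (u ⊗ₜ η)) := by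
          intro u
          induction u with
          | zero => simp only [map_zero, TensorProduct.zero_tmul, LinearMap.zero_apply]
          | add s t hs ht =>
            simp only [map_add, TensorProduct.add_tmul, hs, ht, LinearMap.add_apply]
          | tmul x y => simp
        simp [this]
    rw [LinearMap.comp_apply, LinearMap.comp_apply, key, ← C.coactL_coassoc, ← LinearMap.comp_apply,
      ← LinearMap.lTensor_comp]
    have : (TensorProduct.lift (lact K A Γ) ∘ₗ C.invProj.lTensor A) ∘ₗ C.coactL = LinearMap.id :=
      LinearMap.ext C.lift_lact_invProj
    rw [this, LinearMap.lTensor_id, LinearMap.id_apply]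
  have h₁ := C.lift_antipode_lTensor (diagAct K A Γ) (C.coactL ∘ₗ C.invProj) ω
  have h₂ := C.lift_antipode_lTensor (diagAct K A Γ) (TensorProduct.mk K A Γ 1 ∘ₗ C.invProj) ω
  rw [e₁] at h₁
  rw [e₂, h₁] at h₂
  exact h₂

theorem invProj_mem_leftInvariants (ω : Γ) : C.invProj ω ∈ C.leftInvariants := by
  rw [leftInvariants, LinearMap.mem_ker, LinearMap.sub_apply, coactL_invProj, sub_eq_zero]; rfl

theorem invProj_of_mem {ω : Γ} (hω : ω ∈ C.leftInvariants) : C.invProj ω = ω := by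
  rw [leftInvariants, LinearMap.mem_ker, LinearMap.sub_apply, sub_eq_zero] at hω
  rw [invProj, LinearMap.comp_apply, hω]
  simp [HopfAlgebra.antipode_one]

end BicovariantCalculus

end GeneralCalculus

/-! ### Identities satisfied by a dual frame -/

section FrameTheory

variable {K A Γ : Type*} [Field K] [Ring A] [HopfAlgebra K A] [AddCommGroup Γ] [Module K Γ]
  [Module A Γ] [Module Aᵐᵒᵖ Γ] [IsScalarTower K A Γ] [IsScalarTower K Aᵐᵒᵖ Γ]
  [SMulCommClass A Aᵐᵒᵖ Γ]

/-- `(α ⊗ id) Δ a = α(a₍₁₎) a₍₂₎`. -/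
def leftSlice (α : Module.Dual K A) : A →ₗ[K] A :=
  (TensorProduct.lid K A).toLinearMap ∘ₗ α.rTensor A ∘ₗ Coalgebra.comul (R := K)

theorem leftSlice_apply (α : Module.Dual K A) (a : A) :
    leftSlice α a = TensorProduct.lid K A (α.rTensor A (Coalgebra.comul (R := K) a)) := rfl

theorem convMul_eq_apply_leftSlice (α β : Module.Dual K A) (a : A) :
    (WithConv.toConv α * WithConv.toConv β) a = β (leftSlice α a) := by
  rw [LinearMap.convMul_apply, leftSlice_apply]
  generalize Coalgebra.comul (R := K) a = u
  induction u with
  | zero => simp only [map_zero]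
  | add s t hs ht => simp only [map_add, hs, ht]
  | tmul x y => simp

theorem convMul_eq_apply_starAct (α β : Module.Dual K A) (a : A) :
    (WithConv.toConv α * WithConv.toConv β) a = α (starAct β a) := by
  rw [LinearMap.convMul_apply, starAct]
  generalize Coalgebra.comul (R := K) a = u
  induction u with
  | zero => simp only [map_zero]
  | add s t hs ht => simp only [map_add, hs, ht]
  | tmul x y => simp [mul_comm]

/-- Regrouping the adjoint coaction as `β(S(a₍₁₎) · α(a₍₂₎) a₍₃₎)` exposes the slice `α(a₍₁₎) a₍₂₎`
of the key identity, evaluated on the second leg of `Δ a`. -/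
theorem quantumBracket_apply (α β : Module.Dual K A) (a : A) :
    quantumBracket α β a = β (TensorProduct.lift (LinearMap.mul K A ∘ₗ HopfAlgebra.antipode K)
      ((leftSlice α).lTensor A (Coalgebra.comul (R := K) a))) := by
  have key : ∀ u : A ⊗[K] (A ⊗[K] A),
      LinearMap.mul' K K (TensorProduct.map α β
        ((LinearMap.mul' K A ∘ₗ (HopfAlgebra.antipode K (A := A)).rTensor A).lTensor A
          (TensorProduct.leftComm K A A A u))) =
      β (TensorProduct.lift (LinearMap.mul K A ∘ₗ HopfAlgebra.antipode K)
        (((TensorProduct.lid K A).toLinearMap ∘ₗ α.rTensor A).lTensor A u)) := by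
    intro u
    induction u with
    | zero => simp only [map_zero]
    | add s t hs ht => simp only [map_add, hs, ht]
    | tmul x w =>
      induction w with
      | zero => simp only [map_zero, TensorProduct.tmul_zero]
      | add s t hs ht => simp only [map_add, TensorProduct.tmul_add, hs, ht]
      | tmul y y' => simp
  refine (key _).trans ?_
  rw [LinearMap.comp_apply, ← LinearMap.lTensor_comp_apply]
  rfl

namespace BicovariantCalculus.IsDualFrame

variable {C : BicovariantCalculus K A Γ} {θ : Fin 4 → Γ}
  {p : Γ →ₗ[K] C.quantumLieAlgebra →ₗ[K] K} {χ : Module.Basis (Fin 4) K C.quantumLieAlgebra}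
  {f : Fin 4 → Fin 4 → Module.Dual K A} {v : Fin 4 → Fin 4 → A}

/-- Write `ω = ω_A P(ω_Γ)`; the pairing turns the coefficient `ω_A` into `ε(ω_A)`. -/
theorem pair_invProj (F : C.IsDualFrame θ p χ f v) (ω : Γ) (ψ : C.quantumLieAlgebra) :
    p (C.invProj ω) ψ = p ω ψ := by
  have key : ∀ t : A ⊗[K] Γ, p (TensorProduct.lift (lact K A Γ) (C.invProj.lTensor A t)) ψ =
      p (C.invProj (TensorProduct.lid K Γ
        ((Coalgebra.counit (R := K) (A := A)).rTensor Γ t))) ψ := by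
    intro t
    induction t with
    | zero => simp only [map_zero]
    | add s t hs ht => simp only [map_add, LinearMap.add_apply, hs, ht]
    | tmul c η => simp [F.pair_smul]
  conv_rhs => rw [← C.lift_lact_invProj ω, key, C.coactL_counit]

theorem pair_sum_smul (F : C.IsDualFrame θ p χ f v) (a : Fin 4 → A) (k : Fin 4) :
    p (∑ j, a j • θ j) (χ k) = Coalgebra.counit (R := K) (a k) := by
  simp [map_sum, LinearMap.sum_apply, F.pair_smul, F.dual]

theorem invProj_eq_sum (F : C.IsDualFrame θ p χ f v)
    (hθ : Submodule.span K (Set.range θ) = C.leftInvariants) (ω : Γ) :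
    C.invProj ω = ∑ j, p ω (χ j) • θ j := by
  have key : ∀ η ∈ Submodule.span K (Set.range θ), η = ∑ j, p η (χ j) • θ j := by
    intro η hη
    induction hη using Submodule.span_induction with
    | mem x hx => obtain ⟨i, rfl⟩ := hx; simp [F.dual]
    | zero => simp
    | add x y _ _ hx hy =>
      simp only [map_add, LinearMap.add_apply, add_smul, Finset.sum_add_distrib, ← hx, ← hy]
    | smul r x _ hx =>
      simp only [map_smul, LinearMap.smul_apply, smul_assoc, ← Finset.smul_sum, ← hx]
  have := key _ (hθ ▸ C.invProj_mem_leftInvariants ω)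
  simpa only [F.pair_invProj] using this

/-- The reconstruction of `da` together with `Δ_L d = (id ⊗ d) Δ` gives `da = a₍₁₎ P(d a₍₂₎)`, and
the coordinates of `P(d a₍₂₎)` are the values `χⱼ(a₍₂₎)`. -/
theorem d_eq_sum (F : C.IsDualFrame θ p χ f v)
    (hθ : Submodule.span K (Set.range θ) = C.leftInvariants) (a : A) :
    C.d a = ∑ j, starAct (χ j : Module.Dual K A) a • θ j := by
  have key : ∀ u : A ⊗[K] A,
      TensorProduct.lift (lact K A Γ) (C.invProj.lTensor A (C.d.lTensor A u)) =
      ∑ j, TensorProduct.rid K A ((χ j : Module.Dual K A).lTensor A u) • θ j := by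
    intro u
    induction u with
    | zero => simp
    | add s t hs ht => simp only [map_add, hs, ht, add_smul, Finset.sum_add_distrib]
    | tmul x y =>
      simp [F.invProj_eq_sum hθ, F.pair_d, Finset.smul_sum, smul_comm x]
  rw [← C.lift_lact_invProj (C.d a), C.coactL_d, key]
  rfl

theorem f_apply (F : C.IsDualFrame θ p χ f v) (i k : Fin 4) (a : A) :
    f i k a = p (MulOpposite.op a • θ i) (χ k) := by
  rw [F.comm, F.pair_sum_smul, counit_starAct]

/-- Associativity `θᵢ(ab) = (θᵢ a) b`, read in invariant coordinates. -/
theorem f_mul (F : C.IsDualFrame θ p χ f v) (i k : Fin 4) (a b : A) :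
    f i k (a * b) = ∑ j, f i j a * f j k b := by
  rw [F.f_apply, MulOpposite.op_mul, mul_smul, F.comm a, Finset.smul_sum]
  have sc : ∀ (x : A) (ω : Γ), MulOpposite.op b • x • ω = x • MulOpposite.op b • ω :=
    fun x ω => (smul_comm x (MulOpposite.op b) ω).symm
  simp only [sc, map_sum, LinearMap.sum_apply, F.pair_smul,
    counit_starAct, ← F.f_apply]

theorem χ_one (χ : C.quantumLieAlgebra) : (χ : Module.Dual K A) 1 = 0 :=
  (Submodule.mem_dualAnnihilator _).mp χ.2 1
    (Submodule.mem_sup_left (Submodule.mem_span_singleton_self 1))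

/-- The Leibniz rule paired with `χₖ`: moving `b` through the `θₛ` in `(da) b` produces the
functionals `f_{sk}`. -/
theorem χ_mul (F : C.IsDualFrame θ p χ f v)
    (hθ : Submodule.span K (Set.range θ) = C.leftInvariants) (k : Fin 4) (a b : A) :
    (χ k : Module.Dual K A) (a * b) = ∑ s, (χ s : Module.Dual K A) a * f s k b +
      Coalgebra.counit (R := K) a * (χ k : Module.Dual K A) b := by
  rw [← F.pair_d, C.leibniz, map_add, LinearMap.add_apply, F.pair_smul, F.pair_d, F.d_eq_sum hθ,
    Finset.smul_sum]
  have sc : ∀ (x : A) (ω : Γ), MulOpposite.op b • x • ω = x • MulOpposite.op b • ω :=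
    fun x ω => (smul_comm x (MulOpposite.op b) ω).symm
  simp only [sc, map_sum, LinearMap.sum_apply, F.pair_smul,
    counit_starAct, ← F.f_apply]

/-- The key identity: `Δ_R(da)` is computed in two ways, through `Δ_R d = (d ⊗ id) Δ` and through
the expansion of `da` in the `θₜ`, and the form leg is paired with `χᵢ`. It yields the bracket
formula, the quantum commutator and the equations for the braiding. -/
theorem sum_starAct_mul_v (F : C.IsDualFrame θ p χ f v)
    (hθ : Submodule.span K (Set.range θ) = C.leftInvariants) (i : Fin 4) (a : A) :
    ∑ t, starAct (χ t : Module.Dual K A) a * v i t = leftSlice (χ i : Module.Dual K A) a := by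
  let q : Γ ⊗[K] A →ₗ[K] A := (TensorProduct.lid K A).toLinearMap ∘ₗ (p.flip (χ i)).rTensor A
  have h₁ : q (C.coactR (C.d a)) = leftSlice (χ i : Module.Dual K A) a := by
    rw [C.coactR_d, leftSlice_apply]
    rw [LinearMap.comp_apply, ← LinearMap.rTensor_comp_apply]
    have : p.flip (χ i) ∘ₗ C.d = (χ i : Module.Dual K A) := LinearMap.ext fun x => F.pair_d x _
    rw [this]; rfl
  have h₂ : ∀ (b : A) (t : Fin 4), q (C.coactR (b • θ t)) = b * v i t := by
    intro b t
    have key : ∀ u : A ⊗[K] A, q (lactR K A Γ u (∑ j, θ j ⊗ₜ[K] v j t)) =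
        TensorProduct.lid K A ((Coalgebra.counit (R := K) (A := A)).rTensor A u) * v i t := by
      intro u
      induction u with
      | zero => simp
      | add s t hs ht => simp only [map_add, LinearMap.add_apply, hs, ht, add_mul]
      | tmul x y => simp [q, F.pair_smul, F.dual]
    rw [C.coactR_smul, F.coact, key, Coalgebra.rTensor_counit_comul, TensorProduct.lid_tmul,
      one_smul]
  rw [← h₁, F.d_eq_sum hθ, map_sum, map_sum]
  exact Finset.sum_congr rfl fun t _ => (h₂ _ _).symm

/-- By the key identity, `S(a₍₁₎) χᵢ(a₍₂₎) a₍₃₎ = ∑ₜ S(a₍₁₎) (χₜ ⋆ a₍₂₎) v_{it}`, which collapses to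
`∑ₜ χₜ(a) v_{it}`. With `β = χₖ` this shows that brackets stay in the span of the `χₜ`. -/
theorem quantumBracket_eq_sum (F : C.IsDualFrame θ p χ f v)
    (hθ : Submodule.span K (Set.range θ) = C.leftInvariants) (i : Fin 4) (β : Module.Dual K A) :
    quantumBracket (χ i : Module.Dual K A) β = ∑ t, β (v i t) • (χ t : Module.Dual K A) := by
  ext a
  have e : leftSlice (χ i : Module.Dual K A) =
      ∑ t, LinearMap.mulRight K (v i t) ∘ₗ starLin (χ t : Module.Dual K A) := by
    ext b
    rw [← F.sum_starAct_mul_v hθ]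
    simp [starLin_apply]
  have key : ∀ (t : Fin 4) (u : A ⊗[K] A),
      TensorProduct.lift (LinearMap.mul K A ∘ₗ HopfAlgebra.antipode K)
        ((LinearMap.mulRight K (v i t) ∘ₗ starLin (χ t : Module.Dual K A)).lTensor A u) =
      TensorProduct.lift (LinearMap.mul K A ∘ₗ HopfAlgebra.antipode K)
        ((starLin (χ t : Module.Dual K A)).lTensor A u) * v i t := by
    intro t u
    induction u with
    | zero => simp
    | add s t hs ht => simp only [map_add, hs, ht, add_mul]
    | tmul x y => simp [mul_assoc]
  have hl : ∀ G : Fin 4 → (A →ₗ[K] A), (∑ t, G t).lTensor A = ∑ t, (G t).lTensor A :=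
    fun G => map_sum (LinearMap.lTensorHom (R := K) A) G _
  rw [quantumBracket_apply, e, hl]
  simp [map_sum, LinearMap.sum_apply, key, sum_antipode_mul_starAct, mul_comm]

/-- The quantum Lie bracket is the quantum commutator for the convolution product. -/
theorem quantumBracket_eq_quantumCommutator (F : C.IsDualFrame θ p χ f v)
    (hθ : Submodule.span K (Set.range θ) = C.leftInvariants) (i k : Fin 4) :
    WithConv.toConv (quantumBracket (χ i : Module.Dual K A) (χ k)) =
      quantumCommutator (braiding f v)
        (fun j => WithConv.toConv (χ j : Module.Dual K A)) i k := by
  have key : WithConv.toConv (χ i : Module.Dual K A) * WithConv.toConv (χ k : Module.Dual K A) =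
      WithConv.toConv (quantumBracket (χ i : Module.Dual K A) (χ k)) +
        ∑ s, ∑ t, braiding f v s t i k • (WithConv.toConv (χ s : Module.Dual K A) *
          WithConv.toConv (χ t : Module.Dual K A)) := by
    ext a
    rw [F.quantumBracket_eq_sum hθ]
    have : ∀ x : Fin 4 → WithConv (Module.Dual K A), (∑ j, x j) a = ∑ j, x j a := by
      intro x; simp [Fin.sum_univ_four]
    have hc : ∀ x y : WithConv (Module.Dual K A), (x + y) a = x a + y a := fun _ _ => rfl
    have hs : ∀ (r : K) (x : WithConv (Module.Dual K A)), (r • x) a = r * x a := fun _ _ => rfl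
    rw [hc, this]
    simp only [this, hs, convMul_eq_apply_starAct]
    -- The product `χᵢχₖ` is switched from the star form to the slice form, so that it becomes `χₖ`
    -- of the key identity. In `χ_mul`, the terms with `f_{sk}(v_{it})` are the braided products and
    -- those with the counit are the bracket.
    rw [← convMul_eq_apply_starAct, convMul_eq_apply_leftSlice, ← F.sum_starAct_mul_v hθ, map_sum]
    simp only [F.χ_mul hθ, counit_starAct, Finset.sum_add_distrib]
    rw [add_comm, Finset.sum_comm]
    congr 1
    · simp [mul_comm]
    · simp only [braiding, mul_comm]
  rw [quantumCommutator, key, add_sub_cancel_right]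

end BicovariantCalculus.IsDualFrame

end FrameTheory

/-! ### Existence of a dual frame -/

section FrameExistence

variable {K A Γ : Type*} [Field K] [Ring A] [HopfAlgebra K A] [AddCommGroup Γ] [Module K Γ]
  [Module A Γ] [Module Aᵐᵒᵖ Γ] [IsScalarTower K A Γ] [IsScalarTower K Aᵐᵒᵖ Γ]
  [SMulCommClass A Aᵐᵒᵖ Γ]

namespace BicovariantCalculus

variable (C : BicovariantCalculus K A Γ)

theorem lift_antipode_tmul_one (t : Γ ⊗[K] A) :
    (TensorProduct.lift (lact K A Γ ∘ₗ HopfAlgebra.antipode K)).rTensor A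
      ((TensorProduct.assoc K A Γ A).symm (1 ⊗ₜ t)) = t := by
  induction t with
  | zero => simp only [map_zero, TensorProduct.tmul_zero]
  | add s t hs ht => simp only [map_add, TensorProduct.tmul_add, hs, ht]
  | tmul ω a => simp [HopfAlgebra.antipode_one]

/-- The right coaction maps left-invariant forms to left-invariant forms. -/
theorem rTensor_invProj_coactR {ω : Γ} (hω : ω ∈ C.leftInvariants) :
    C.invProj.rTensor A (C.coactR ω) = C.coactR ω := by
  have hω' : C.coactL ω = 1 ⊗ₜ ω := by
    rwa [leftInvariants, LinearMap.mem_ker, LinearMap.sub_apply, sub_eq_zero] at hω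
  -- For invariant `ω` the bicomodule axiom reads `1 ⊗ Δ_R ω = (Δ_L ⊗ id) Δ_R ω`, and `S(1) = 1`.
  have h := C.bicomodule ω
  rw [hω', LinearMap.lTensor_tmul, ← LinearEquiv.symm_apply_eq] at h
  rw [invProj, LinearMap.rTensor_comp_apply, ← h, lift_antipode_tmul_one]

/-- A basis of left-invariant forms of the shape `P(d eᵢ)` determines a dual frame. -/
theorem exists_isDualFrame {θ : Fin 4 → Γ} (e : Fin 4 → A) (hli : LinearIndependent K θ)
    (hspan : Submodule.span K (Set.range θ) = C.leftInvariants)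
    (he : ∀ i, θ i = C.invProj (C.d (e i))) :
    ∃ p χ f v, C.IsDualFrame θ p χ f v := by
  classical
  have hmem : ∀ ω, C.invProj ω ∈ Submodule.span K (Set.range θ) := fun ω =>
    hspan ▸ C.invProj_mem_leftInvariants ω
  let b := Module.Basis.span hli
  have hb : ∀ i, (b i : Γ) = θ i := fun i =>
    congrArg Subtype.val (Module.Basis.span_apply hli i)
  -- The coordinates of `P(ω)` in the basis `θ`; the pairing, `χ`, `f` and `v` are all built from
  -- these functionals.
  let c : Fin 4 → Γ →ₗ[K] K := fun j => b.coord j ∘ₗ C.invProj.codRestrict _ hmem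
  have hc : ∀ ω, C.invProj ω = ∑ j, c j ω • θ j := by
    intro ω
    have := congrArg (Subtype.val) (b.sum_repr (C.invProj.codRestrict _ hmem ω))
    rw [Submodule.coe_sum] at this
    simp only [Submodule.coe_smul, hb] at this
    exact this.symm
  have hcs : ∀ (a : A) (ω : Γ) (j : Fin 4),
      c j (a • ω) = Coalgebra.counit (R := K) a * c j ω := by
    intro a ω j
    have : C.invProj.codRestrict _ hmem (a • ω) =
        Coalgebra.counit (R := K) a • C.invProj.codRestrict _ hmem ω :=
      Subtype.ext (C.invProj_smul a ω)
    simp [c, this]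
  have hθ : ∀ i, θ i ∈ C.leftInvariants := fun i =>
    hspan ▸ Submodule.subset_span (Set.mem_range_self i)
  have hcθ : ∀ i j, c j (θ i) = if i = j then 1 else 0 := by
    intro i j
    have : C.invProj.codRestrict _ hmem (θ i) = b i :=
      Subtype.ext ((C.invProj_of_mem (hθ i)).trans (hb i).symm)
    simp only [c, LinearMap.comp_apply, this, Module.Basis.coord_apply, Module.Basis.repr_self,
      Finsupp.single_apply]
  have hcP : ∀ ω j, c j (C.invProj ω) = c j ω := by
    intro ω j
    rw [hc ω, map_sum]
    simp [hcθ]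
  -- These will be the `χⱼ`. They vanish on `1` because `d 1 = 0`, and on `R` because `c j` sees a
  -- form only through `P`.
  have hX : ∀ j, c j ∘ₗ C.d ∈ C.quantumLieAlgebra := by
    intro j
    rw [quantumLieAlgebra, Submodule.mem_dualAnnihilator]
    intro a ha
    refine Submodule.mem_sup.mp ha |>.elim ?_
    rintro x ⟨hx, y, hy, rfl⟩
    obtain ⟨r, rfl⟩ := Submodule.mem_span_singleton.mp hx
    have hy' : C.invProj (C.d y) = 0 := hy.2
    simp only [map_add, map_smul, LinearMap.comp_apply, C.d_one, map_zero, smul_zero, zero_add]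
    rw [← hcP, hy', map_zero]
  have hval : ∀ (ψ : C.quantumLieAlgebra) (a : A), (ψ : Module.Dual K A) a =
      ∑ j, c j (C.d a) * (ψ : Module.Dual K A) (e j) := by
    intro ψ a
    have h1 : (ψ : Module.Dual K A) 1 = 0 := IsDualFrame.χ_one ψ
    -- By construction `P(dy) = 0`; subtracting `ε(y) 1` puts the element into `R` without changing
    -- the value of `ψ`. Hence `ψ` is determined by its values on the `e j`.
    let y := a - ∑ j, c j (C.d a) • e j
    have hy : y - Coalgebra.counit (R := K) y • 1 ∈ C.relIdeal := by
      refine ⟨?_, ?_⟩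
      · rw [SetLike.mem_coe, LinearMap.mem_ker]; simp
      · rw [SetLike.mem_coe, LinearMap.mem_ker]
        simp only [y, map_sub, map_smul, map_sum, LinearMap.comp_apply, C.d_one, map_zero,
          smul_zero, sub_zero, ← he]
        rw [hc, sub_self]
    have := (Submodule.mem_dualAnnihilator _).mp ψ.2 _ (Submodule.mem_sup_right hy)
    simp only [y, map_sub, map_smul, map_sum, h1, smul_eq_mul, mul_zero, sub_zero] at this
    exact sub_eq_zero.mp this
  let X : Fin 4 → C.quantumLieAlgebra := fun j => ⟨c j ∘ₗ C.d, hX j⟩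
  have hXe : ∀ i j, (X j : Module.Dual K A) (e i) = if i = j then 1 else 0 := by
    intro i j
    change c j (C.d (e i)) = _
    rw [← hcP, ← he, hcθ]
  -- Evaluation on the `e j` is bijective: injective by `hval`, and the `X j` realise the standard
  -- basis.
  let E : C.quantumLieAlgebra ≃ₗ[K] (Fin 4 → K) :=
    { toFun := fun ψ j => (ψ : Module.Dual K A) (e j)
      map_add' := fun _ _ => rfl
      map_smul' := fun _ _ => rfl
      invFun := fun r => ∑ j, r j • X j
      left_inv := by
        intro ψ
        refine Subtype.ext (LinearMap.ext fun a => ?_)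
        rw [hval ψ a]
        simp [X, mul_comm]
      right_inv := by
        intro r
        funext i
        simp [hXe] }
  let χ : Module.Basis (Fin 4) K C.quantumLieAlgebra := Module.Basis.ofEquivFun E
  have hχ : ∀ j, χ j = X j := by
    intro j
    rw [Module.Basis.coe_ofEquivFun]
    change ∑ i, (Pi.single j (1 : K) : Fin 4 → K) i • X i = X j
    simp [Pi.single_apply]
  let p : Γ →ₗ[K] C.quantumLieAlgebra →ₗ[K] K :=
    ∑ j, (c j).smulRight (LinearMap.proj j ∘ₗ E.toLinearMap)
  have hp : ∀ ω ψ, p ω ψ = ∑ j, c j ω * (ψ : Module.Dual K A) (e j) := by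
    intro ω ψ
    simp only [p, LinearMap.sum_apply, LinearMap.smulRight_apply, LinearMap.smul_apply]
    rfl
  have hpχ : ∀ ω j, p ω (χ j) = c j ω := by
    intro ω j
    simp [hp, hχ, hXe]
  -- The defining equations force these choices: `f_{ij}(a)` is the `j`-th invariant coordinate of
  -- `θᵢ a`, and `v_{ji}` is the slice of `Δ_R θᵢ` along `c j`.
  let f : Fin 4 → Fin 4 → Module.Dual K A := fun i j => c j ∘ₗ (ract K A Γ).flip (θ i)
  let v : Fin 4 → Fin 4 → A := fun j i =>
    TensorProduct.lid K A ((c j).rTensor A (C.coactR (θ i)))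
  refine ⟨p, χ, f, fun i j => v i j, ?_, ?_, ?_, ?_, ?_⟩
  · intro a ω ψ
    simp only [hp, hcs, Finset.mul_sum, mul_assoc]
  · intro a ψ
    rw [hp, ← hval]
  · intro i j
    rw [hpχ, hcθ]
  · intro a i
    -- Since `θᵢ` is invariant, `Δ_L(θᵢ a) = a₍₁₎ ⊗ θᵢ a₍₂₎`, and reconstruction gives `θᵢ a = a₍₁₎
    -- P(θᵢ a₍₂₎)`.
    rw [← C.lift_lact_invProj (MulOpposite.op a • θ i), C.coactL_op_smul]
    have hi : C.coactL (θ i) = 1 ⊗ₜ θ i := by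
      have := hθ i
      rwa [leftInvariants, LinearMap.mem_ker, LinearMap.sub_apply, sub_eq_zero] at this
    have key : ∀ u : A ⊗[K] A,
        TensorProduct.lift (lact K A Γ) (C.invProj.lTensor A (ractL K A Γ u (1 ⊗ₜ θ i))) =
        ∑ j, TensorProduct.rid K A ((f i j).lTensor A u) • θ j := by
      intro u
      induction u with
      | zero => simp
      | add s t hs ht =>
        simp only [map_add, LinearMap.add_apply, hs, ht, add_smul, Finset.sum_add_distrib]
      | tmul x y =>
        have : ractL K A Γ (x ⊗ₜ y) (1 ⊗ₜ θ i) = (1 * x) ⊗ₜ (MulOpposite.op y • θ i) := rfl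
        rw [this, one_mul]
        simp [hc, f, Finset.smul_sum, smul_comm x]
    rw [hi, key]
    rfl
  · intro i
    have key : ∀ t : Γ ⊗[K] A, C.invProj.rTensor A t =
        ∑ j, θ j ⊗ₜ[K] TensorProduct.lid K A ((c j).rTensor A t) := by
      intro t
      induction t with
      | zero => simp
      | add s t hs ht => simp only [map_add, hs, ht, TensorProduct.tmul_add, Finset.sum_add_distrib]
      | tmul ω a => simp [hc, TensorProduct.sum_tmul, TensorProduct.smul_tmul]
    -- The form legs of `Δ_R θᵢ` may be projected by `P`, hence expanded in the `θⱼ`.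
    rw [← C.rTensor_invProj_coactR (hθ i), key]

end BicovariantCalculus

end FrameExistence

theorem map_quantumCommutator {K B B' : Type*} [Field K] [Ring B] [Algebra K B] [Ring B']
    [Algebra K B'] (φ : B →ₐ[K] B') (Λ : Fin 4 → Fin 4 → Fin 4 → Fin 4 → K) (X : Fin 4 → B)
    (i k : Fin 4) :
    φ (quantumCommutator Λ X i k) = quantumCommutator Λ (fun j => φ (X j)) i k := by
  simp only [quantumCommutator, map_sub, map_mul, map_sum, map_smul]

/-! ### The braiding and the brackets on `GL_{h,g}(2)` from the `ABCD` matrices -/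

section Jordanian

variable {K Γ : Type*} [Field K] {h g : K} [AddCommGroup Γ] [Module K Γ]
  [Module (JordanianGL h g) Γ] [Module (JordanianGL h g)ᵐᵒᵖ Γ]
  [IsScalarTower K (JordanianGL h g) Γ] [IsScalarTower K (JordanianGL h g)ᵐᵒᵖ Γ]
  [SMulCommClass (JordanianGL h g) (JordanianGL h g)ᵐᵒᵖ Γ]

namespace JordanianGL

variable (h g) in
/-- The matrix entries `a, b, c, d`. -/
def entry : Fin 4 → JordanianGL h g := ![gen h g .a, gen h g .b, gen h g .c, gen h g .d]

variable (h g) in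
/-- Evaluation of functionals on the matrix entries, an algebra map for the convolution product. -/
def evalEntries : WithConv (Module.Dual K (JordanianGL h g)) →ₐ[K] Matrix (Fin 2) (Fin 2) K :=
  AlgHom.ofLinearMap
    { toFun := fun α => !![α (gen h g .a), α (gen h g .b); α (gen h g .c), α (gen h g .d)]
      map_add' := fun α β => by
        ext i j
        fin_cases i <;> fin_cases j <;> rfl
      map_smul' := fun r α => by
        ext i j
        fin_cases i <;> fin_cases j <;> rfl }
    (by
      ext i j
      fin_cases i <;> fin_cases j <;>
        simp [LinearMap.convOne_apply, counit_gen, counitGen])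
    (fun α β => by
      ext i j
      fin_cases i <;> fin_cases j <;>
        simp [LinearMap.convMul_apply, comul_gen, comulGen, Matrix.mul_apply, Fin.sum_univ_two])

theorem evalEntries_apply (α : WithConv (Module.Dual K (JordanianGL h g))) :
    evalEntries h g α = !![α (gen h g .a), α (gen h g .b); α (gen h g .c), α (gen h g .d)] := rfl

end JordanianGL

namespace BicovariantCalculus

variable {C : BicovariantCalculus K (JordanianGL h g) Γ}

theorem theta_eq (C : BicovariantCalculus K (JordanianGL h g) Γ) (i : Fin 4) :
    C.theta i = C.invProj (C.d (JordanianGL.entry h g i)) := by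
  fin_cases i <;> rfl

theorem HasABCD.exists_isDualFrame {A B C' D : Matrix (Fin 4) (Fin 4) K}
    (H : C.HasABCD A B C' D) : ∃ p χ f v, C.IsDualFrame C.theta p χ f v :=
  C.exists_isDualFrame (JordanianGL.entry h g) H.linearIndependent H.span_eq C.theta_eq

/-- The `2 × 2` matrix units `e₁₁, e₁₂, e₂₁, e₂₂`. -/
def matrixUnit (K : Type*) [Field K] : Fin 4 → Matrix (Fin 2) (Fin 2) K :=
  ![!![1, 0; 0, 0], !![0, 1; 0, 0], !![0, 0; 1, 0], !![0, 0; 0, 1]]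

/-- The components of the braiding in terms of the `ABCD` matrices and of the blocks `S, S', T, T'`
of the inverse of the block matrix `(A B; C D)`: the matrix `(Λ_{st,ik})_{sk}` for given `i`, `t`. -/
def blockBraiding {R : Type*} [Mul R] (A B C D S S' T T' : R) : Fin 4 → Fin 4 → R :=
  ![![S * A, S * B, T * A, T * B],
    ![S * C, S * D, T * C, T * D],
    ![S' * A, S' * B, T' * A, T' * B],
    ![S' * C, S' * D, T' * C, T' * D]]

/-- Block elimination over a noncommutative ring, needing only a left inverse `(S S'; T T')` of `(A
B; C D)`. -/
theorem solve_block {R : Type*} [Ring R] {A B C D S S' T T' x y u w : R}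
    (hA : S * A + S' * C = 1) (hB : S * B + S' * D = 0)
    (hC : T * A + T' * C = 0) (hD : T * B + T' * D = 1)
    (h₁ : A * x + B * y = u) (h₂ : C * x + D * y = w) :
    x = S * u + S' * w ∧ y = T * u + T' * w := by
  subst h₁ h₂
  constructor
  · calc x = (S * A + S' * C) * x + (S * B + S' * D) * y := by rw [hA, hB]; simp
      _ = _ := by noncomm_ring
  · calc y = (T * A + T' * C) * x + (T * B + T' * D) * y := by rw [hC, hD]; simp
      _ = _ := by noncomm_ring

namespace IsDualFrame

variable {p : Γ →ₗ[K] C.quantumLieAlgebra →ₗ[K] K}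
  {χ : Module.Basis (Fin 4) K C.quantumLieAlgebra}
  {f : Fin 4 → Fin 4 → Module.Dual K (JordanianGL h g)} {v : Fin 4 → Fin 4 → JordanianGL h g}

open JordanianGL

/-- Because `θᵢ` is `P` of the differential of the `i`-th entry, and the pairing does not
distinguish `ω` from `P(ω)`. -/
theorem χ_entry (F : C.IsDualFrame C.theta p χ f v) (i j : Fin 4) :
    (χ j : Module.Dual K (JordanianGL h g)) (entry h g i) = if i = j then 1 else 0 := by
  rw [← F.pair_d, ← F.pair_invProj, ← theta_eq, F.dual]

theorem χ_a (F : C.IsDualFrame C.theta p χ f v) (j : Fin 4) :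
    (χ j : Module.Dual K (JordanianGL h g)) (gen h g .a) = if 0 = j then 1 else 0 := F.χ_entry 0 j

theorem χ_b (F : C.IsDualFrame C.theta p χ f v) (j : Fin 4) :
    (χ j : Module.Dual K (JordanianGL h g)) (gen h g .b) = if 1 = j then 1 else 0 := F.χ_entry 1 j

theorem χ_c (F : C.IsDualFrame C.theta p χ f v) (j : Fin 4) :
    (χ j : Module.Dual K (JordanianGL h g)) (gen h g .c) = if 2 = j then 1 else 0 := F.χ_entry 2 j

theorem χ_d (F : C.IsDualFrame C.theta p χ f v) (j : Fin 4) :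
    (χ j : Module.Dual K (JordanianGL h g)) (gen h g .d) = if 3 = j then 1 else 0 := F.χ_entry 3 j

theorem evalEntries_χ (F : C.IsDualFrame C.theta p χ f v) (j : Fin 4) :
    evalEntries h g (WithConv.toConv (χ j : Module.Dual K (JordanianGL h g))) = matrixUnit K j := by
  rw [evalEntries_apply]
  change !![(χ j : Module.Dual K (JordanianGL h g)) (gen h g .a),
    (χ j : Module.Dual K (JordanianGL h g)) (gen h g .b);
    (χ j : Module.Dual K (JordanianGL h g)) (gen h g .c),
    (χ j : Module.Dual K (JordanianGL h g)) (gen h g .d)] = _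
  rw [F.χ_a, F.χ_b, F.χ_c, F.χ_d]
  fin_cases j <;> rfl

/-- The matrix representation `x ↦ (f_{ij}(x))`. -/
def repr (f : Fin 4 → Fin 4 → Module.Dual K (JordanianGL h g)) :
    JordanianGL h g →ₗ[K] Matrix (Fin 4) (Fin 4) K where
  toFun x := Matrix.of fun i j => f i j x
  map_add' x y := by ext i j; simp
  map_smul' r x := by ext i j; simp

theorem repr_mul (F : C.IsDualFrame C.theta p χ f v) (x y : JordanianGL h g) :
    repr f (x * y) = repr f x * repr f y := by
  ext i j
  simp [repr, F.f_mul, Matrix.mul_apply]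

section

variable {A B C' D : Matrix (Fin 4) (Fin 4) K}

/-- Pairing with `χₖ` applies the counit to the coefficient of `θₖ`; of the two entries in that
coefficient the diagonal one survives and the off-diagonal one is killed. The same holds for `b`,
`c`, `d`. -/
theorem repr_a (F : C.IsDualFrame C.theta p χ f v) (H : C.HasABCD A B C' D) :
    repr f (gen h g .a) = A := by
  ext i k
  change f i k _ = _
  rw [F.f_apply, H.comm_a, F.pair_sum_smul]
  simp [counit_gen, counitGen]

theorem repr_b (F : C.IsDualFrame C.theta p χ f v) (H : C.HasABCD A B C' D) :
    repr f (gen h g .b) = B := by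
  ext i k
  change f i k _ = _
  rw [F.f_apply, H.comm_b, F.pair_sum_smul]
  simp [counit_gen, counitGen]

theorem repr_c (F : C.IsDualFrame C.theta p χ f v) (H : C.HasABCD A B C' D) :
    repr f (gen h g .c) = C' := by
  ext i k
  change f i k _ = _
  rw [F.f_apply, H.comm_c, F.pair_sum_smul]
  simp [counit_gen, counitGen]

theorem repr_d (F : C.IsDualFrame C.theta p χ f v) (H : C.HasABCD A B C' D) :
    repr f (gen h g .d) = D := by
  ext i k
  change f i k _ = _
  rw [F.f_apply, H.comm_d, F.pair_sum_smul]
  simp [counit_gen, counitGen]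

/-- With `V_{it} = (f_{sk}(v_{it}))_{sk}`, the image of the key identity at `a` and `c` is a system
in `V_{i0}`, `V_{i2}`, and at `b` and `d` one in `V_{i1}`, `V_{i3}`. Both have coefficient matrix
`(A B; C D)`. So the braiding is computed without knowing the `v_{it}` themselves. -/
theorem braiding_eq_blockBraiding (F : C.IsDualFrame C.theta p χ f v) (H : C.HasABCD A B C' D)
    {S S' T T' : Matrix (Fin 4) (Fin 4) K}
    (hA : S * A + S' * C' = 1) (hB : S * B + S' * D = 0)
    (hC : T * A + T' * C' = 0) (hD : T * B + T' * D = 1) :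
    braiding f v = fun s t i k => blockBraiding A B C' D S S' T T' i t s k := by
  suffices key : ∀ i t, repr f (v i t) = blockBraiding A B C' D S S' T T' i t by
    funext s t i k
    rw [← key]; rfl
  intro i
  -- For instance, at `a` this is `A V_{i0} + B V_{i2} = δ_{i0} A + δ_{i1} C'`, from `Δ a = a ⊗ a +
  -- b ⊗ c`.
  have e := fun x => congrArg (repr f) (F.sum_starAct_mul_v H.span_eq i x)
  have ea := e (gen h g .a)
  have eb := e (gen h g .b)
  have ec := e (gen h g .c)
  have ed := e (gen h g .d)
  simp only [Fin.sum_univ_four, starAct, leftSlice_apply, comul_gen, comulGen, map_add,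
    LinearMap.lTensor_tmul, LinearMap.rTensor_tmul, TensorProduct.rid_tmul, TensorProduct.lid_tmul,
    F.χ_a, F.χ_b, F.χ_c, F.χ_d, add_mul, smul_mul_assoc, map_smul, F.repr_mul, F.repr_a H,
    F.repr_b H, F.repr_c H, F.repr_d H] at ea eb ec ed
  have h₀ := solve_block hA hB hC hD (x := repr f (v i 0)) (y := repr f (v i 2))
    (by simpa using ea) (by simpa using ec)
  have h₁ := solve_block hA hB hC hD (x := repr f (v i 1)) (y := repr f (v i 3))
    (by simpa using eb) (by simpa using ed)
  intro t
  fin_cases t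
  · exact h₀.1.trans (by fin_cases i <;> simp [blockBraiding])
  · exact h₁.1.trans (by fin_cases i <;> simp [blockBraiding])
  · exact h₀.2.trans (by fin_cases i <;> simp [blockBraiding])
  · exact h₁.2.trans (by fin_cases i <;> simp [blockBraiding])

end

/-- The structure constants of the quantum Lie algebra are the entries of the quantum commutators
of the `2 × 2` matrix units. -/
theorem quantumBracket_eq_matrixUnit (F : C.IsDualFrame C.theta p χ f v)
    (hθ : Submodule.span K (Set.range C.theta) = C.leftInvariants) (i k : Fin 4) :
    quantumBracket (χ i : Module.Dual K (JordanianGL h g)) (χ k) =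
      quantumCommutator (braiding f v) (matrixUnit K) i k 0 0 •
          (χ 0 : Module.Dual K (JordanianGL h g)) +
        quantumCommutator (braiding f v) (matrixUnit K) i k 0 1 •
          (χ 1 : Module.Dual K (JordanianGL h g)) +
        quantumCommutator (braiding f v) (matrixUnit K) i k 1 0 •
          (χ 2 : Module.Dual K (JordanianGL h g)) +
        quantumCommutator (braiding f v) (matrixUnit K) i k 1 1 •
          (χ 3 : Module.Dual K (JordanianGL h g)) := by
  -- The four coefficients of the bracket are its values on `a, b, c, d`; the algebra map
  -- `evalEntries` carries the quantum commutator of the `χⱼ` to that of the matrix units.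
  have e := congrArg (evalEntries h g) (F.quantumBracket_eq_quantumCommutator hθ i k)
  rw [map_quantumCommutator] at e
  simp only [F.evalEntries_χ] at e
  have hb := F.quantumBracket_eq_sum hθ i (χ k : Module.Dual K (JordanianGL h g))
  rw [← e, hb, evalEntries_apply, Fin.sum_univ_four]
  simp [F.χ_a, F.χ_b, F.χ_c, F.χ_d]

end IsDualFrame

end BicovariantCalculus

end Jordanian

theorem forall_fin_four {P : Fin 4 → Prop} (h₀ : P 0) (h₁ : P 1) (h₂ : P 2) (h₃ : P 3) (i : Fin 4) :
    P i := by
  fin_cases i <;> assumption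

/-! ### First family: inverse blocks and tables -/

namespace BicovariantCalculus

/-- The matrices `A, B, C, D` of the first family. -/
def abcd₁ {K : Type*} [Field K] (h g z : K) : Fin 4 → Matrix (Fin 4) (Fin 4) K :=
  ![!![(3 * z + 2) / 2, 0, (-(3 * h + g) * z - 2 * h) / 2, -z / 2;
       h * (z + 1), z + 1, -h ^ 2 * (z + 1), -h * (z + 1);
       0, 0, z + 1, 0;
       z / 2, 0, ((h - g) * z + 2 * h) / 2, (z + 2) / 2],
    !![0, z, h * (h + g) * (z + 1), 0;
       0, (h + g) * (z + 1), -h * g * (h + g) * (z + 1), 0;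
       0, 0, -(h + g) * (z + 1), 0;
       0, z, g * (h + g) * (z + 1), 0],
    !![0, 0, z, 0;
       0, 0, 0, 0;
       0, 0, 0, 0;
       0, 0, z, 0],
    !![(z + 2) / 2, 0, (-(h - g) * z + 2 * g) / 2, z / 2;
       -g * (z + 1), z + 1, -g ^ 2 * (z + 1), g * (z + 1);
       0, 0, z + 1, 0;
       -z / 2, 0, (-(h + 3 * g) * z - 2 * g) / 2, (3 * z + 2) / 2]]

/-- The blocks of the inverse of `(A B; C D)` for the first family. -/
def invBlocks₁ {K : Type*} [Field K] (h g z : K) : Fin 4 → Matrix (Fin 4) (Fin 4) K :=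
  ![!![(z + 2) / (2 * (z + 1) ^ 2), 0, ((h + g) * z + 2 * h) / (2 * (z + 1) ^ 2),
         z / (2 * (z + 1) ^ 2);
       -h / (z + 1), 1 / (z + 1), -h ^ 2 / (z + 1), h / (z + 1);
       0, 0, 1 / (z + 1), 0;
       -z / (2 * (z + 1) ^ 2), 0, ((g - 3 * h) * z - 2 * h) / (2 * (z + 1) ^ 2),
         (3 * z + 2) / (2 * (z + 1) ^ 2)],
    !![-g * z / (z + 1) ^ 2, -z / (z + 1) ^ 2, g ^ 2 * z / (z + 1) ^ 2, g * z / (z + 1) ^ 2;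
       -g * (h + g) / (z + 1), -(h + g) / (z + 1), g ^ 2 * (h + g) / (z + 1),
         g * (h + g) / (z + 1);
       0, 0, (h + g) / (z + 1), 0;
       -g * z / (z + 1) ^ 2, -z / (z + 1) ^ 2,
         -(g ^ 2 + 2 * h * g * (z + 1) + h ^ 2 * (z + 1)) / (z + 1) ^ 2, g * z / (z + 1) ^ 2],
    !![0, 0, -z / (z + 1) ^ 2, 0;
       0, 0, 0, 0;
       0, 0, 0, 0;
       0, 0, -z / (z + 1) ^ 2, 0],
    !![(3 * z + 2) / (2 * (z + 1) ^ 2), 0, (-(h + 5 * g) * z - 2 * g) / (2 * (z + 1) ^ 2),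
         -z / (2 * (z + 1) ^ 2);
       g / (z + 1), 1 / (z + 1), -g ^ 2 / (z + 1), -g / (z + 1);
       0, 0, 1 / (z + 1), 0;
       z / (2 * (z + 1) ^ 2), 0, (-(h + g) * z + 2 * g) / (2 * (z + 1) ^ 2),
         (z + 2) / (2 * (z + 1) ^ 2)]]

section

variable {K : Type*} [Field K]

/-- This and the next three lemmas are the four block entries of the statement that the chosen
blocks form a left inverse of `(A B; C D)`. The only factors inverted are `2` and `z + 1`. -/
theorem invBlocks₁_mul_a (h2 : (2 : K) ≠ 0) (h g : K) {z : K} (hz : z + 1 ≠ 0) :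
    invBlocks₁ h g z 0 * abcd₁ h g z 0 +
      invBlocks₁ h g z 1 * abcd₁ h g z 2 = 1 := by
  ext i j
  revert i j
  refine forall_fin_four ?_ ?_ ?_ ?_ <;> refine forall_fin_four ?_ ?_ ?_ ?_ <;>
    simp only [invBlocks₁, abcd₁, Matrix.add_apply, Matrix.mul_apply, Fin.sum_univ_four,
      Matrix.of_apply, Matrix.cons_val, Matrix.one_apply, Matrix.zero_apply, Fin.reduceEq,
      if_true, if_false]
  all_goals (try field_simp)
  all_goals ring

theorem invBlocks₁_mul_b (h2 : (2 : K) ≠ 0) (h g : K) {z : K} (hz : z + 1 ≠ 0) :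
    invBlocks₁ h g z 0 * abcd₁ h g z 1 +
      invBlocks₁ h g z 1 * abcd₁ h g z 3 = 0 := by
  ext i j
  revert i j
  refine forall_fin_four ?_ ?_ ?_ ?_ <;> refine forall_fin_four ?_ ?_ ?_ ?_ <;>
    simp only [invBlocks₁, abcd₁, Matrix.add_apply, Matrix.mul_apply, Fin.sum_univ_four,
      Matrix.of_apply, Matrix.cons_val, Matrix.one_apply, Matrix.zero_apply, Fin.reduceEq,
      if_true, if_false]
  all_goals (try field_simp)
  all_goals ring

theorem invBlocks₁_mul_c (h2 : (2 : K) ≠ 0) (h g : K) {z : K} (hz : z + 1 ≠ 0) :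
    invBlocks₁ h g z 2 * abcd₁ h g z 0 +
      invBlocks₁ h g z 3 * abcd₁ h g z 2 = 0 := by
  ext i j
  revert i j
  refine forall_fin_four ?_ ?_ ?_ ?_ <;> refine forall_fin_four ?_ ?_ ?_ ?_ <;>
    simp only [invBlocks₁, abcd₁, Matrix.add_apply, Matrix.mul_apply, Fin.sum_univ_four,
      Matrix.of_apply, Matrix.cons_val, Matrix.one_apply, Matrix.zero_apply, Fin.reduceEq,
      if_true, if_false]
  all_goals (try field_simp)
  all_goals ring

theorem invBlocks₁_mul_d (h2 : (2 : K) ≠ 0) (h g : K) {z : K} (hz : z + 1 ≠ 0) :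
    invBlocks₁ h g z 2 * abcd₁ h g z 1 +
      invBlocks₁ h g z 3 * abcd₁ h g z 3 = 1 := by
  ext i j
  revert i j
  refine forall_fin_four ?_ ?_ ?_ ?_ <;> refine forall_fin_four ?_ ?_ ?_ ?_ <;>
    simp only [invBlocks₁, abcd₁, Matrix.add_apply, Matrix.mul_apply, Fin.sum_univ_four,
      Matrix.of_apply, Matrix.cons_val, Matrix.one_apply, Matrix.zero_apply, Fin.reduceEq,
      if_true, if_false]
  all_goals (try field_simp)
  all_goals ring

-- The algebra and the `X j` are arbitrary because the identity is used in three places: the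
-- convolution algebra, the tensor algebra and the `2 × 2` matrices.
set_option maxHeartbeats 4000000 in
theorem quantumCommutator_eq_table₁ (h2 : (2 : K) ≠ 0) (h g : K) {z : K} (hz : z + 1 ≠ 0) {B : Type*}
    [Ring B] [Algebra K B] (X : Fin 4 → B) (i k : Fin 4) :
    quantumCommutator (fun s t i k => blockBraiding (abcd₁ h g z 0) (abcd₁ h g z 1)
      (abcd₁ h g z 2) (abcd₁ h g z 3) (invBlocks₁ h g z 0) (invBlocks₁ h g z 1)
      (invBlocks₁ h g z 2) (invBlocks₁ h g z 3) i t s k) X i k =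
      commutatorTable₁ h g z (X 0) (X 1) (X 2) (X 3) i k := by
  revert i k
  refine forall_fin_four ?_ ?_ ?_ ?_ <;> refine forall_fin_four ?_ ?_ ?_ ?_ <;>
    simp only [quantumCommutator, blockBraiding, commutatorTable₁, invBlocks₁, abcd₁,
      Matrix.mul_apply, Fin.sum_univ_four, Matrix.of_apply, Matrix.cons_val] <;>
    -- The products `X s * X t` are treated as independent atoms, so this compares the braiding with
    -- the table component by component.
    match_scalars
  all_goals (try field_simp)
  all_goals ring

/-- Links the two tables: substituting matrix units for the `χⱼ` in a tabulated commutator leaves a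
`2 × 2` matrix whose entries are the structure constants. -/
theorem commutatorTable₁_matrixUnit (h g : K) {z : K} (hz : z + 1 ≠ 0) {V : Type*}
    [AddCommGroup V] [Module K V] (x : Fin 4 → V) (i k : Fin 4) :
    let M := commutatorTable₁ h g z (matrixUnit K 0) (matrixUnit K 1) (matrixUnit K 2)
      (matrixUnit K 3) i k
    M 0 0 • x 0 + M 0 1 • x 1 + M 1 0 • x 2 + M 1 1 • x 3 =
      bracketTable₁ h g z (x 0) (x 1) (x 2) (x 3) i k := by
  revert i k
  refine forall_fin_four ?_ ?_ ?_ ?_ <;> refine forall_fin_four ?_ ?_ ?_ ?_ <;>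
    simp only [matrixUnit, commutatorTable₁, bracketTable₁, Matrix.mul_apply, Fin.sum_univ_two,
      Matrix.of_apply, Matrix.cons_val, Matrix.sub_apply, Matrix.add_apply, Matrix.neg_apply,
      Matrix.smul_apply, Matrix.zero_apply, smul_eq_mul, mul_zero, mul_one, zero_mul, add_zero,
      zero_add, sub_zero, zero_sub, neg_zero, zero_smul, sub_self] <;>
    match_scalars
  all_goals (try field_simp)
  all_goals ring

end


/-! ### Second family: inverse blocks and tables -/

/-- The matrices `A, B, C, D` of the second family. -/
def abcd₂ {K : Type*} [Field K] (h g z : K) : Fin 4 → Matrix (Fin 4) (Fin 4) K :=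
  ![!![(z + 2) / 2, 0, ((h + g) * z - 2 * h) / 2, z / 2;
       h * (z + 1), 1, h * ((h + g) * z - h), h * (z - 1);
       0, 0, 1, 0;
       -z / 2, 0, (-(h + g) * z + 2 * h) / 2, (-z + 2) / 2],
    !![-h * z, 0, h * (h + g) * (1 - z), -h * z;
       h * g * z, h + g, h * g * (h + g) * (z - 1), g * h * z;
       z, 0, (h + g) * (z - 1), z;
       -g * z, 0, g * (h + g) * (1 - z), -g * z],
    !![0, 0, 0, 0;
       z, 0, (h + g) * z, z;
       0, 0, 0, 0;
       0, 0, 0, 0],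
    !![(-z + 2) / 2, 0, (-(h + g) * z + 2 * g) / 2, -z / 2;
       g * (z - 1), 1, g * ((h + g) * z - g), g * (z + 1);
       0, 0, 1, 0;
       z / 2, 0, ((h + g) * z - 2 * g) / 2, (z + 2) / 2]]

/-- The blocks of the inverse of `(A B; C D)` for the second family. -/
def invBlocks₂ {K : Type*} [Field K] (h g z : K) : Fin 4 → Matrix (Fin 4) (Fin 4) K :=
  ![!![(-z + 2) / 2, 0, (-(h + g) * z + 2 * h) / 2, -z / 2;
       g * z - h + h * z, 1, (g + h) ^ 2 * z - h ^ 2, (h + g) * z + h;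
       0, 0, 1, 0;
       z / 2, 0, ((h + g) * z - 2 * h) / 2, (z + 2) / 2],
    !![0, 0, 0, 0;
       -g * (h + g), -(h + g), g ^ 2 * (h + g), g * (h + g);
       -z, 0, (h + g) * (1 - z), -z;
       (h + g) * z, 0, (h + g) ^ 2 * (z - 1), (h + g) * z],
    !![0, 0, 0, 0;
       -z, 0, -(h + g) * z, -z;
       0, 0, 0, 0;
       0, 0, 0, 0],
    !![(z + 2) / 2, 0, ((h + g) * z - 2 * g) / 2, z / 2;
       g, 1, -g ^ 2, -g;
       0, 0, 1, 0;
       -z / 2, 0, (-(h + g) * z + 2 * g) / 2, (-z + 2) / 2]]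

section

variable {K : Type*} [Field K]

/-- The inverse blocks are polynomial in `z` up to denominators `2`, which is why this family has no
excluded parameter. -/
theorem invBlocks₂_mul_a (h2 : (2 : K) ≠ 0) (h g : K) {z : K} :
    invBlocks₂ h g z 0 * abcd₂ h g z 0 +
      invBlocks₂ h g z 1 * abcd₂ h g z 2 = 1 := by
  ext i j
  revert i j
  refine forall_fin_four ?_ ?_ ?_ ?_ <;> refine forall_fin_four ?_ ?_ ?_ ?_ <;>
    simp only [invBlocks₂, abcd₂, Matrix.add_apply, Matrix.mul_apply, Fin.sum_univ_four,
      Matrix.of_apply, Matrix.cons_val, Matrix.one_apply, Matrix.zero_apply, Fin.reduceEq,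
      if_true, if_false]
  all_goals (try field_simp)
  all_goals ring

theorem invBlocks₂_mul_b (h2 : (2 : K) ≠ 0) (h g : K) {z : K} :
    invBlocks₂ h g z 0 * abcd₂ h g z 1 +
      invBlocks₂ h g z 1 * abcd₂ h g z 3 = 0 := by
  ext i j
  revert i j
  refine forall_fin_four ?_ ?_ ?_ ?_ <;> refine forall_fin_four ?_ ?_ ?_ ?_ <;>
    simp only [invBlocks₂, abcd₂, Matrix.add_apply, Matrix.mul_apply, Fin.sum_univ_four,
      Matrix.of_apply, Matrix.cons_val, Matrix.one_apply, Matrix.zero_apply, Fin.reduceEq,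
      if_true, if_false]
  all_goals (try field_simp)
  all_goals ring

theorem invBlocks₂_mul_c (h2 : (2 : K) ≠ 0) (h g : K) {z : K} :
    invBlocks₂ h g z 2 * abcd₂ h g z 0 +
      invBlocks₂ h g z 3 * abcd₂ h g z 2 = 0 := by
  ext i j
  revert i j
  refine forall_fin_four ?_ ?_ ?_ ?_ <;> refine forall_fin_four ?_ ?_ ?_ ?_ <;>
    simp only [invBlocks₂, abcd₂, Matrix.add_apply, Matrix.mul_apply, Fin.sum_univ_four,
      Matrix.of_apply, Matrix.cons_val, Matrix.one_apply, Matrix.zero_apply, Fin.reduceEq,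
      if_true, if_false]
  all_goals (try field_simp)
  all_goals ring

theorem invBlocks₂_mul_d (h2 : (2 : K) ≠ 0) (h g : K) {z : K} :
    invBlocks₂ h g z 2 * abcd₂ h g z 1 +
      invBlocks₂ h g z 3 * abcd₂ h g z 3 = 1 := by
  ext i j
  revert i j
  refine forall_fin_four ?_ ?_ ?_ ?_ <;> refine forall_fin_four ?_ ?_ ?_ ?_ <;>
    simp only [invBlocks₂, abcd₂, Matrix.add_apply, Matrix.mul_apply, Fin.sum_univ_four,
      Matrix.of_apply, Matrix.cons_val, Matrix.one_apply, Matrix.zero_apply, Fin.reduceEq,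
      if_true, if_false]
  all_goals (try field_simp)
  all_goals ring

set_option maxHeartbeats 4000000 in
theorem quantumCommutator_eq_table₂ (h2 : (2 : K) ≠ 0) (h g : K) {z : K} {B : Type*}
    [Ring B] [Algebra K B] (X : Fin 4 → B) (i k : Fin 4) :
    quantumCommutator (fun s t i k => blockBraiding (abcd₂ h g z 0) (abcd₂ h g z 1)
      (abcd₂ h g z 2) (abcd₂ h g z 3) (invBlocks₂ h g z 0) (invBlocks₂ h g z 1)
      (invBlocks₂ h g z 2) (invBlocks₂ h g z 3) i t s k) X i k =
      commutatorTable₂ h g z (X 0) (X 1) (X 2) (X 3) i k := by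
  revert i k
  refine forall_fin_four ?_ ?_ ?_ ?_ <;> refine forall_fin_four ?_ ?_ ?_ ?_ <;>
    simp only [quantumCommutator, blockBraiding, commutatorTable₂, invBlocks₂, abcd₂,
      Matrix.mul_apply, Fin.sum_univ_four, Matrix.of_apply, Matrix.cons_val] <;>
    match_scalars
  all_goals (try field_simp)
  all_goals ring

theorem commutatorTable₂_matrixUnit (h g z : K) {V : Type*}
    [AddCommGroup V] [Module K V] (x : Fin 4 → V) (i k : Fin 4) :
    let M := commutatorTable₂ h g z (matrixUnit K 0) (matrixUnit K 1) (matrixUnit K 2)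
      (matrixUnit K 3) i k
    M 0 0 • x 0 + M 0 1 • x 1 + M 1 0 • x 2 + M 1 1 • x 3 =
      bracketTable₂ h g z (x 0) (x 1) (x 2) (x 3) i k := by
  revert i k
  refine forall_fin_four ?_ ?_ ?_ ?_ <;> refine forall_fin_four ?_ ?_ ?_ ?_ <;>
    simp only [matrixUnit, commutatorTable₂, bracketTable₂, Matrix.mul_apply, Fin.sum_univ_two,
      Matrix.of_apply, Matrix.cons_val, Matrix.sub_apply, Matrix.add_apply, Matrix.neg_apply,
      Matrix.smul_apply, Matrix.zero_apply, smul_eq_mul, mul_zero, mul_one, zero_mul, add_zero,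
      zero_add, sub_zero, zero_sub, neg_zero, zero_smul, sub_self] <;>
    match_scalars
  all_goals ring

end


/-! ### Third family: inverse blocks and tables -/

/-- The matrices `A, B, C, D` of the third family. -/
def abcd₃ {K : Type*} [Field K] (h g z : K) : Fin 4 → Matrix (Fin 4) (Fin 4) K :=
  ![!![(z + 2) / 2, 0, ((h + g) * z - 2 * h) / 2, z / 2;
       h, 1, -h ^ 2, -h;
       0, 0, 1, 0;
       z / 2, 0, ((h + g) * z + 2 * h) / 2, (z + 2) / 2],
    !![0, 0, h * (h + g), 0;
       0, h + g, -h * g * (h + g), 0;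
       0, 0, -(h + g), 0;
       0, 0, g * (h + g), 0],
    !![0, 0, 0, 0;
       0, 0, 0, 0;
       0, 0, 0, 0;
       0, 0, 0, 0],
    !![(z + 2) / 2, 0, ((h + g) * z + 2 * g) / 2, z / 2;
       -g, 1, -g ^ 2, g;
       0, 0, 1, 0;
       z / 2, 0, ((h + g) * z - 2 * g) / 2, (z + 2) / 2]]

/-- The blocks of the inverse of `(A B; C D)` for the third family. -/
def invBlocks₃ {K : Type*} [Field K] (h g z : K) : Fin 4 → Matrix (Fin 4) (Fin 4) K :=
  ![!![(z + 2) / (2 * (z + 1)), 0, ((h - g) * z + 2 * h) / (2 * (z + 1)), -z / (2 * (z + 1));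
       -h, 1, -h ^ 2, h;
       0, 0, 1, 0;
       -z / (2 * (z + 1)), 0, (-(3 * h + g) * z - 2 * h) / (2 * (z + 1)), (z + 2) / (2 * (z + 1))],
    !![0, 0, 0, 0;
       -g * (h + g), -(h + g), g ^ 2 * (h + g), g * (h + g);
       0, 0, h + g, 0;
       0, 0, -(h + g) ^ 2, 0],
    !![0, 0, 0, 0;
       0, 0, 0, 0;
       0, 0, 0, 0;
       0, 0, 0, 0],
    !![(z + 2) / (2 * (z + 1)), 0, (-(h + 3 * g) * z - 2 * g) / (2 * (z + 1)), -z / (2 * (z + 1));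
       g, 1, -g ^ 2, -g;
       0, 0, 1, 0;
       -z / (2 * (z + 1)), 0, ((g - h) * z + 2 * g) / (2 * (z + 1)), (z + 2) / (2 * (z + 1))]]

section

variable {K : Type*} [Field K]

theorem invBlocks₃_mul_a (h2 : (2 : K) ≠ 0) (h g : K) {z : K} (hz : z + 1 ≠ 0) :
    invBlocks₃ h g z 0 * abcd₃ h g z 0 +
      invBlocks₃ h g z 1 * abcd₃ h g z 2 = 1 := by
  ext i j
  revert i j
  refine forall_fin_four ?_ ?_ ?_ ?_ <;> refine forall_fin_four ?_ ?_ ?_ ?_ <;>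
    simp only [invBlocks₃, abcd₃, Matrix.add_apply, Matrix.mul_apply, Fin.sum_univ_four,
      Matrix.of_apply, Matrix.cons_val, Matrix.one_apply, Matrix.zero_apply, Fin.reduceEq,
      if_true, if_false]
  all_goals (try field_simp)
  all_goals ring

theorem invBlocks₃_mul_b (h2 : (2 : K) ≠ 0) (h g : K) {z : K} (hz : z + 1 ≠ 0) :
    invBlocks₃ h g z 0 * abcd₃ h g z 1 +
      invBlocks₃ h g z 1 * abcd₃ h g z 3 = 0 := by
  ext i j
  revert i j
  refine forall_fin_four ?_ ?_ ?_ ?_ <;> refine forall_fin_four ?_ ?_ ?_ ?_ <;>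
    simp only [invBlocks₃, abcd₃, Matrix.add_apply, Matrix.mul_apply, Fin.sum_univ_four,
      Matrix.of_apply, Matrix.cons_val, Matrix.one_apply, Matrix.zero_apply, Fin.reduceEq,
      if_true, if_false]
  all_goals (try field_simp)
  all_goals ring

theorem invBlocks₃_mul_c (h2 : (2 : K) ≠ 0) (h g : K) {z : K} (hz : z + 1 ≠ 0) :
    invBlocks₃ h g z 2 * abcd₃ h g z 0 +
      invBlocks₃ h g z 3 * abcd₃ h g z 2 = 0 := by
  ext i j
  revert i j
  refine forall_fin_four ?_ ?_ ?_ ?_ <;> refine forall_fin_four ?_ ?_ ?_ ?_ <;>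
    simp only [invBlocks₃, abcd₃, Matrix.add_apply, Matrix.mul_apply, Fin.sum_univ_four,
      Matrix.of_apply, Matrix.cons_val, Matrix.one_apply, Matrix.zero_apply, Fin.reduceEq,
      if_true, if_false]
  all_goals (try field_simp)
  all_goals ring

theorem invBlocks₃_mul_d (h2 : (2 : K) ≠ 0) (h g : K) {z : K} (hz : z + 1 ≠ 0) :
    invBlocks₃ h g z 2 * abcd₃ h g z 1 +
      invBlocks₃ h g z 3 * abcd₃ h g z 3 = 1 := by
  ext i j
  revert i j
  refine forall_fin_four ?_ ?_ ?_ ?_ <;> refine forall_fin_four ?_ ?_ ?_ ?_ <;>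
    simp only [invBlocks₃, abcd₃, Matrix.add_apply, Matrix.mul_apply, Fin.sum_univ_four,
      Matrix.of_apply, Matrix.cons_val, Matrix.one_apply, Matrix.zero_apply, Fin.reduceEq,
      if_true, if_false]
  all_goals (try field_simp)
  all_goals ring

-- The parameter `z` cancels in every product of an inverse block with one of `A, B, C, D`: the
-- braiding of this family does not depend on `z`, although the calculus does.
set_option maxHeartbeats 4000000 in
theorem quantumCommutator_eq_table₃ (h2 : (2 : K) ≠ 0) (h g : K) {z : K} (hz : z + 1 ≠ 0) {B : Type*}
    [Ring B] [Algebra K B] (X : Fin 4 → B) (i k : Fin 4) :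
    quantumCommutator (fun s t i k => blockBraiding (abcd₃ h g z 0) (abcd₃ h g z 1)
      (abcd₃ h g z 2) (abcd₃ h g z 3) (invBlocks₃ h g z 0) (invBlocks₃ h g z 1)
      (invBlocks₃ h g z 2) (invBlocks₃ h g z 3) i t s k) X i k =
      commutatorTable₃ h g (X 0) (X 1) (X 2) (X 3) i k := by
  revert i k
  refine forall_fin_four ?_ ?_ ?_ ?_ <;> refine forall_fin_four ?_ ?_ ?_ ?_ <;>
    simp only [quantumCommutator, blockBraiding, commutatorTable₃, invBlocks₃, abcd₃,
      Matrix.mul_apply, Fin.sum_univ_four, Matrix.of_apply, Matrix.cons_val] <;>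
    match_scalars
  all_goals (try field_simp)
  all_goals ring

theorem commutatorTable₃_matrixUnit (h g : K) {V : Type*}
    [AddCommGroup V] [Module K V] (x : Fin 4 → V) (i k : Fin 4) :
    let M := commutatorTable₃ h g (matrixUnit K 0) (matrixUnit K 1) (matrixUnit K 2)
      (matrixUnit K 3) i k
    M 0 0 • x 0 + M 0 1 • x 1 + M 1 0 • x 2 + M 1 1 • x 3 =
      bracketTable₃ h g (x 0) (x 1) (x 2) (x 3) i k := by
  revert i k
  refine forall_fin_four ?_ ?_ ?_ ?_ <;> refine forall_fin_four ?_ ?_ ?_ ?_ <;>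
    simp only [matrixUnit, commutatorTable₃, bracketTable₃, Matrix.mul_apply, Fin.sum_univ_two,
      Matrix.of_apply, Matrix.cons_val, Matrix.sub_apply, Matrix.add_apply, Matrix.neg_apply,
      Matrix.smul_apply, Matrix.zero_apply, smul_eq_mul, mul_zero, mul_one, zero_mul, add_zero,
      zero_add, sub_zero, zero_sub, neg_zero, zero_smul, sub_self] <;>
    match_scalars
  all_goals ring

end

end BicovariantCalculus

end

/-! ### The theorem -/

/-- The quantum Lie brackets and the quantum commutators of the quantum Lie algebras of the three
families of 4D calculi on `GL_{h,g}(2)`. Products of functionals are convolution products; the last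
clause compares the quantum commutators in the tensor algebra of the quantum Lie algebra, so that it
records every component of the braiding `Λ`. -/
theorem mainTheorem4 {K : Type*} [Field K] (h2 : (2 : K) ≠ 0) (h g z : K)
    {Γ : Type*} [AddCommGroup Γ] [Module K Γ]
    [Module (JordanianGL h g) Γ] [Module (JordanianGL h g)ᵐᵒᵖ Γ]
    [IsScalarTower K (JordanianGL h g) Γ] [IsScalarTower K (JordanianGL h g)ᵐᵒᵖ Γ]
    [SMulCommClass (JordanianGL h g) (JordanianGL h g)ᵐᵒᵖ Γ]
    (C : BicovariantCalculus K (JordanianGL h g) Γ) :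
    (z ≠ -1 → C.IsFamily₁ z →
      (∃ p χ f v, C.IsDualFrame C.theta p χ f v) ∧
      ∀ p χ f v, C.IsDualFrame C.theta p χ f v → ∀ i k : Fin 4,
        quantumBracket (χ i : Module.Dual K (JordanianGL h g)) (χ k) =
            bracketTable₁ h g z (χ 0 : Module.Dual K (JordanianGL h g)) (χ 1) (χ 2) (χ 3) i k ∧
          WithConv.toConv (quantumBracket (χ i : Module.Dual K (JordanianGL h g)) (χ k)) =
            quantumCommutator (braiding f v)
              (fun j => WithConv.toConv (χ j : Module.Dual K (JordanianGL h g))) i k ∧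
          WithConv.toConv (quantumBracket (χ i : Module.Dual K (JordanianGL h g)) (χ k)) =
            commutatorTable₁ h g z
              (WithConv.toConv (χ 0 : Module.Dual K (JordanianGL h g)))
              (WithConv.toConv (χ 1 : Module.Dual K (JordanianGL h g)))
              (WithConv.toConv (χ 2 : Module.Dual K (JordanianGL h g)))
              (WithConv.toConv (χ 3 : Module.Dual K (JordanianGL h g))) i k ∧
          quantumCommutator (braiding f v) (fun j => TensorAlgebra.ι K (χ j)) i k =
            commutatorTable₁ h g z (TensorAlgebra.ι K (χ 0)) (TensorAlgebra.ι K (χ 1))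
              (TensorAlgebra.ι K (χ 2)) (TensorAlgebra.ι K (χ 3)) i k) ∧
    (C.IsFamily₂ z →
      (∃ p χ f v, C.IsDualFrame C.theta p χ f v) ∧
      ∀ p χ f v, C.IsDualFrame C.theta p χ f v → ∀ i k : Fin 4,
        quantumBracket (χ i : Module.Dual K (JordanianGL h g)) (χ k) =
            bracketTable₂ h g z (χ 0 : Module.Dual K (JordanianGL h g)) (χ 1) (χ 2) (χ 3) i k ∧
          WithConv.toConv (quantumBracket (χ i : Module.Dual K (JordanianGL h g)) (χ k)) =
            quantumCommutator (braiding f v)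
              (fun j => WithConv.toConv (χ j : Module.Dual K (JordanianGL h g))) i k ∧
          WithConv.toConv (quantumBracket (χ i : Module.Dual K (JordanianGL h g)) (χ k)) =
            commutatorTable₂ h g z
              (WithConv.toConv (χ 0 : Module.Dual K (JordanianGL h g)))
              (WithConv.toConv (χ 1 : Module.Dual K (JordanianGL h g)))
              (WithConv.toConv (χ 2 : Module.Dual K (JordanianGL h g)))
              (WithConv.toConv (χ 3 : Module.Dual K (JordanianGL h g))) i k ∧
          quantumCommutator (braiding f v) (fun j => TensorAlgebra.ι K (χ j)) i k =
            commutatorTable₂ h g z (TensorAlgebra.ι K (χ 0)) (TensorAlgebra.ι K (χ 1))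
              (TensorAlgebra.ι K (χ 2)) (TensorAlgebra.ι K (χ 3)) i k) ∧
    (z ≠ -1 → C.IsFamily₃ z →
      (∃ p χ f v, C.IsDualFrame C.theta p χ f v) ∧
      ∀ p χ f v, C.IsDualFrame C.theta p χ f v → ∀ i k : Fin 4,
        quantumBracket (χ i : Module.Dual K (JordanianGL h g)) (χ k) =
            bracketTable₃ h g (χ 0 : Module.Dual K (JordanianGL h g)) (χ 1) (χ 2) (χ 3) i k ∧
          WithConv.toConv (quantumBracket (χ i : Module.Dual K (JordanianGL h g)) (χ k)) =
            quantumCommutator (braiding f v)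
              (fun j => WithConv.toConv (χ j : Module.Dual K (JordanianGL h g))) i k ∧
          WithConv.toConv (quantumBracket (χ i : Module.Dual K (JordanianGL h g)) (χ k)) =
            commutatorTable₃ h g
              (WithConv.toConv (χ 0 : Module.Dual K (JordanianGL h g)))
              (WithConv.toConv (χ 1 : Module.Dual K (JordanianGL h g)))
              (WithConv.toConv (χ 2 : Module.Dual K (JordanianGL h g)))
              (WithConv.toConv (χ 3 : Module.Dual K (JordanianGL h g))) i k ∧
          quantumCommutator (braiding f v) (fun j => TensorAlgebra.ι K (χ j)) i k =
            commutatorTable₃ h g (TensorAlgebra.ι K (χ 0)) (TensorAlgebra.ι K (χ 1))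
              (TensorAlgebra.ι K (χ 2)) (TensorAlgebra.ι K (χ 3)) i k) := by
  refine ⟨?_, ?_, ?_⟩
  · intro hz H
    -- The matrices of the family are those of `abcd₁` by definition; naming them lets the
    -- inverse-block lemmas apply.
    replace H : C.HasABCD
      (BicovariantCalculus.abcd₁ h g z 0) (BicovariantCalculus.abcd₁ h g z 1)
      (BicovariantCalculus.abcd₁ h g z 2) (BicovariantCalculus.abcd₁ h g z 3) := H
    replace hz : z + 1 ≠ 0 := fun e => hz (eq_neg_of_add_eq_zero_left e)
    refine ⟨H.exists_isDualFrame, fun p χ f v F i k => ?_⟩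
    have hΛ := F.braiding_eq_blockBraiding H (BicovariantCalculus.invBlocks₁_mul_a h2 h g hz)
      (BicovariantCalculus.invBlocks₁_mul_b h2 h g hz)
      (BicovariantCalculus.invBlocks₁_mul_c h2 h g hz)
      (BicovariantCalculus.invBlocks₁_mul_d h2 h g hz)
    have hb := F.quantumBracket_eq_quantumCommutator H.span_eq i k
    refine ⟨?_, hb, hb.trans ?_, ?_⟩
    -- Here the commutator table is used for matrix units, to read off the structure constants; the
    -- two remaining goals use it in the convolution algebra and in the tensor algebra.
    · rw [F.quantumBracket_eq_matrixUnit H.span_eq, hΛ,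
        BicovariantCalculus.quantumCommutator_eq_table₁ h2 h g hz]
      exact BicovariantCalculus.commutatorTable₁_matrixUnit h g hz
        (fun j => (χ j : Module.Dual K (JordanianGL h g))) i k
    · rw [hΛ]
      exact BicovariantCalculus.quantumCommutator_eq_table₁ h2 h g hz _ i k
    · rw [hΛ]
      exact BicovariantCalculus.quantumCommutator_eq_table₁ h2 h g hz _ i k
  · intro H
    replace H : C.HasABCD
      (BicovariantCalculus.abcd₂ h g z 0) (BicovariantCalculus.abcd₂ h g z 1)
      (BicovariantCalculus.abcd₂ h g z 2) (BicovariantCalculus.abcd₂ h g z 3) := H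
    refine ⟨H.exists_isDualFrame, fun p χ f v F i k => ?_⟩
    have hΛ := F.braiding_eq_blockBraiding H (BicovariantCalculus.invBlocks₂_mul_a h2 h g)
      (BicovariantCalculus.invBlocks₂_mul_b h2 h g)
      (BicovariantCalculus.invBlocks₂_mul_c h2 h g)
      (BicovariantCalculus.invBlocks₂_mul_d h2 h g)
    have hb := F.quantumBracket_eq_quantumCommutator H.span_eq i k
    refine ⟨?_, hb, hb.trans ?_, ?_⟩
    · rw [F.quantumBracket_eq_matrixUnit H.span_eq, hΛ,
        BicovariantCalculus.quantumCommutator_eq_table₂ h2 h g]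
      exact BicovariantCalculus.commutatorTable₂_matrixUnit h g z
        (fun j => (χ j : Module.Dual K (JordanianGL h g))) i k
    · rw [hΛ]
      exact BicovariantCalculus.quantumCommutator_eq_table₂ h2 h g _ i k
    · rw [hΛ]
      exact BicovariantCalculus.quantumCommutator_eq_table₂ h2 h g _ i k
  · intro hz H
    replace H : C.HasABCD
      (BicovariantCalculus.abcd₃ h g z 0) (BicovariantCalculus.abcd₃ h g z 1)
      (BicovariantCalculus.abcd₃ h g z 2) (BicovariantCalculus.abcd₃ h g z 3) := H
    replace hz : z + 1 ≠ 0 := fun e => hz (eq_neg_of_add_eq_zero_left e)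
    refine ⟨H.exists_isDualFrame, fun p χ f v F i k => ?_⟩
    have hΛ := F.braiding_eq_blockBraiding H (BicovariantCalculus.invBlocks₃_mul_a h2 h g hz)
      (BicovariantCalculus.invBlocks₃_mul_b h2 h g hz)
      (BicovariantCalculus.invBlocks₃_mul_c h2 h g hz)
      (BicovariantCalculus.invBlocks₃_mul_d h2 h g hz)
    have hb := F.quantumBracket_eq_quantumCommutator H.span_eq i k
    refine ⟨?_, hb, hb.trans ?_, ?_⟩
    · rw [F.quantumBracket_eq_matrixUnit H.span_eq, hΛ,
        BicovariantCalculus.quantumCommutator_eq_table₃ h2 h g hz]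
      exact BicovariantCalculus.commutatorTable₃_matrixUnit h g
        (fun j => (χ j : Module.Dual K (JordanianGL h g))) i k
    · rw [hΛ]
      exact BicovariantCalculus.quantumCommutator_eq_table₃ h2 h g hz _ i k
    · rw [hΛ]
      exact BicovariantCalculus.quantumCommutator_eq_table₃ h2 h g hz _ i k
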